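/- Let $c_2>0$, $h,q\in\mathbb R$ and consider, on $(x,t)\in(0,1)\times(0,\infty)$, the closed loop $$u_{tt}=c_1^2u_{xx},\quad v_{tt}=c_2^2v_{xx},\qquad u_x(0,t)=g\,u_t(0,t),\quad u(1,t)=v(0,t),\quad v_x(0,t)=u_x(1,t),\quad v_x(1,t)=-h\,v_t(1,t)-q\,v(1,t),$$ with initial condition $(u^0,u_t^0,v^0,v_t^0)$ in $$\mathcal H=\{(u,u_t,v,v_t)\in H^1\times L^2\times H^1\times L^2:\ u(1)=v(0)\}\quad\text{(spaces over }[0,1]).$$ It is written as $\dot X=AX$ in $\mathcal H$, with $A(u,p,v,r)=(p,c_1^2u_{xx},r,c_2^2v_{xx})$ on the set of all $(u,p,v,r)\in\mathcal H$ with $u,v\in H^2$, $p,r\in H^1$, $p(1)=r(0)$, $u_x(0)=g\,p(0)$, $v_x(0)=u_x(1)$ and $v_x(1)=-h\,r(1)-q\,v(1)$. A solution with initial condition $X_0\in\mathcal H$ is a continuous $X:[0,\infty)\to\mathcal H$ with $X(0)=X_0$ such that, for all $t\ge0$, $\int_0^tX(s)\,ds$ lies in the domain of $A$ and $X(t)-X_0=A\int_0^tX(s)\,ds$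 (mild solution). Put $$\|(u,u_t,v,v_t)\|_{\mathcal H}^2=c_1^2\|u_x\|_{L^2}^2+\|u_t\|_{L^2}^2+c_2^2\|v_x\|_{L^2}^2+\|v_t\|_{L^2}^2 .$$ A solution $X$ is $\mathcal H$-exponentially stable if there are $\gamma>1$, $\alpha>0$ with $\|X(t)\|_{\mathcal H}\le\gamma\,\|X(0)\|_{\mathcal H}\,e^{-\alpha t}$ for all $t\ge0$. For real numbers $S_1,S_2,S_3,S_4>0$ and $S_5$ let $$\Psi_{c_1,z}=H_{c_1,z}^\top S\,H_{c_1,z}-G_{c_1,z}^\top S\,G_{c_1,z}+Q,\qquad S=\mathrm{diag}(S_1,S_2,S_3,S_4),$$ $$H_{c_1,z}=\begin{bmatrix}0&c_1&1&0&0\\1-z&0&0&0&0\\0&0&0&1-c_2h&-c_2q\\0&-c_2&1&0&0\end{bmatrix},\quad G_{c_1,z}=\begin{bmatrix}1+z&0&0&0&0\\0&-c_1&1&0&0\\0&c_2&1&0&0\\0&0&0&1+c_2h&c_2q\end{bmatrix},$$ where $Q\in\mathbb R^{5\times5}$ has entries $Q_{45}=Q_{54}=S_5$ and all others zero, and let $\tilde\Psi_{c_1,z}$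 be the upper left $4\times4$ block of $\Psi_{c_1,z}$ (it does not depend on $q$ and $S_5$). **Theorem.** Let $0<c_{min}\le c_{max}$, $g_{min}\le g_{max}$, $$\mathcal D=\{c_1g:\ c_1\in[c_{min},c_{max}],\ g\in[g_{min},g_{max}]\},\qquad \delta_{max}=\max_{z\in\mathcal D}\left|\frac{1-z}{1+z}\right|$$ (with value $\infty$ at $z=-1$), and let $z_{max}\in\mathcal D$ be a point at which the maximum is attained. Suppose that $1\le\delta_{max}<\infty$ and that, for some $S_1,S_2,S_3,S_4>0$ and $S_5\in\mathbb R$, * either $\Psi_{c_{min},z_{max}}\prec0$ and $\Psi_{c_{max},z_{max}}\prec0$, * or $q=0$ and $\tilde\Psi_{c_{min},z_{max}}\prec0$ and $\tilde\Psi_{c_{max},z_{max}}\prec0$. Then for every $c_1\in[c_{min},c_{max}]$, every $g\in[g_{min},g_{max}]$ and every initial condition in $\mathcal H$ the closed loop has a unique solution, and this solution is $\mathcal H$-exponentially stable. -/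

import Mathlib

open MeasureTheory Set
open scoped NNReal ENNReal

namespace StringLoop

noncomputable section

/-! ### Function spaces on `[0,1]` -/

/-- Lebesgue measure on `[0,1]`. -/
abbrev unitMeasure : Measure ℝ := volume.restrict (Icc (0 : ℝ) 1)

/-- The space `L² = L²([0,1]; ℝ)`. -/
abbrev L2 : Type := Lp ℝ 2 unitMeasure

theorem Ioc_subset_unit (x : unitInterval) : Ioc (0 : ℝ) x ⊆ Icc (0 : ℝ) 1 :=
  fun _ hy => ⟨hy.1.le, hy.2.trans x.2.2⟩

theorem L2.intervalIntegrable (w : L2) (x : unitInterval) :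
    IntervalIntegrable (w : ℝ → ℝ) volume 0 (x : ℝ) := by
  have h : Integrable (w : ℝ → ℝ) unitMeasure := (Lp.memLp w).integrable (by norm_num)
  have h2 : IntegrableOn (w : ℝ → ℝ) (Icc 0 1) volume := h
  exact (intervalIntegrable_iff_integrableOn_Ioc_of_le x.2.1).2
    (h2.mono_set (Ioc_subset_unit x))

theorem L2.continuous_intervalIntegral (x : unitInterval) :
    Continuous fun w : L2 => ∫ s in (0 : ℝ)..x, w s := by
  have hfin : unitMeasure (Ioc (0 : ℝ) x) ≠ ∞ := measure_ne_top _ _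
  have key : (fun w : L2 => ∫ s in (0 : ℝ)..x, w s) =
      fun w : L2 => inner ℝ (indicatorConstLp 2 measurableSet_Ioc hfin (1 : ℝ)) w := by
    funext w
    rw [L2.inner_indicatorConstLp_one measurableSet_Ioc hfin w,
      intervalIntegral.integral_of_le x.2.1, Measure.restrict_restrict measurableSet_Ioc,
      inter_eq_self_of_subset_left (Ioc_subset_unit x)]
  rw [key]
  fun_prop

/-- The Sobolev space `H¹ = H¹([0,1]; ℝ)`. An element is a pair `(f, f_x)`, where `f` is the
continuous representative of the function and `f_x ∈ L²` its (weak) derivative, that is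
`f(x) = f(0) + ∫₀ˣ f_x` for all `x ∈ [0,1]`; `f_x` is determined by `f`. The topology inherited
from `C([0,1]) × L²` is that of the usual `H¹` norm. -/
def sobolevH1 : Submodule ℝ (C(unitInterval, ℝ) × L2) where
  carrier := {f | ∀ x : unitInterval, f.1 x = f.1 0 + ∫ s in (0 : ℝ)..x, f.2 s}
  zero_mem' := by
    intro x
    have h : ∫ s in (0 : ℝ)..x, ((0 : L2) : ℝ → ℝ) s = 0 := by
      rw [intervalIntegral.integral_of_le x.2.1]
      refine integral_eq_zero_of_ae ?_
      refine Filter.EventuallyEq.filter_mono (Lp.coeFn_zero ℝ 2 unitMeasure) (ae_mono ?_)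
      exact Measure.restrict_mono (Ioc_subset_unit x) le_rfl
    simpa using h.symm
  add_mem' := by
    intro a b ha hb x
    have h : ∫ s in (0 : ℝ)..x, ((a.2 + b.2 : L2) : ℝ → ℝ) s =
        ∫ s in (0 : ℝ)..x, (a.2 s + b.2 s) := by
      rw [intervalIntegral.integral_of_le x.2.1, intervalIntegral.integral_of_le x.2.1]
      refine integral_congr_ae ?_
      refine Filter.EventuallyEq.filter_mono (Lp.coeFn_add a.2 b.2) (ae_mono ?_)
      exact Measure.restrict_mono (Ioc_subset_unit x) le_rfl
    have ha' := ha x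
    have hb' := hb x
    simp only [Prod.fst_add, Prod.snd_add, ContinuousMap.add_apply]
    rw [h, intervalIntegral.integral_add (L2.intervalIntegrable _ _) (L2.intervalIntegrable _ _),
      ha', hb']
    ring
  smul_mem' := by
    intro r a ha x
    have h : ∫ s in (0 : ℝ)..x, ((r • a.2 : L2) : ℝ → ℝ) s =
        ∫ s in (0 : ℝ)..x, r * a.2 s := by
      rw [intervalIntegral.integral_of_le x.2.1, intervalIntegral.integral_of_le x.2.1]
      refine integral_congr_ae ?_
      refine Filter.EventuallyEq.filter_mono (Lp.coeFn_smul r a.2) (ae_mono ?_)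
      exact Measure.restrict_mono (Ioc_subset_unit x) le_rfl
    have ha' := ha x
    simp only [Prod.smul_fst, Prod.smul_snd, ContinuousMap.smul_apply, smul_eq_mul]
    rw [h, intervalIntegral.integral_const_mul, ha']
    ring

/-- Elements of `H¹`, with the norm of `C([0,1]) × L²`. -/
def H1 : Type := sobolevH1

instance : NormedAddCommGroup H1 := inferInstanceAs (NormedAddCommGroup sobolevH1)

instance : NormedSpace ℝ H1 := inferInstanceAs (NormedSpace ℝ sobolevH1)

/-- The value `f(x)` of `f ∈ H¹` at a point of `[0,1]`. -/
def H1.value (f : H1) (x : unitInterval) : ℝ := f.1.1 x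

/-- The derivative `f_x ∈ L²` of `f ∈ H¹`. -/
def H1.dx (f : H1) : L2 := f.1.2

/-- The `L²` class `w` contains the `H¹` function `f`. -/
def H1.Represents (f : H1) (w : L2) : Prop :=
  ∀ᵐ x ∂unitMeasure, w x = IccExtend (zero_le_one' ℝ) f.value x

theorem H1.isClosed : IsClosed (sobolevH1 : Set (C(unitInterval, ℝ) × L2)) := by
  have h : (sobolevH1 : Set (C(unitInterval, ℝ) × L2)) =
      ⋂ x : unitInterval, {f | f.1 x = f.1 0 + ∫ s in (0 : ℝ)..x, f.2 s} := by
    ext f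
    simp [sobolevH1]
  rw [h]
  refine isClosed_iInter fun x => isClosed_eq ?_ ?_
  · exact (continuous_eval_const x).comp continuous_fst
  · exact ((continuous_eval_const 0).comp continuous_fst).add
      ((L2.continuous_intervalIntegral x).comp continuous_snd)

instance : CompleteSpace H1 :=
  have h : CompleteSpace sobolevH1 := H1.isClosed.completeSpace_coe
  h

/-- The state space
`𝓗 = {(u, u_t, v, v_t) ∈ H¹ × L² × H¹ × L² : u(1) = v(0)}`. -/
def energySpace : Submodule ℝ (H1 × L2 × H1 × L2) where
  carrier := {X | X.1.value 1 = X.2.2.1.value 0}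
  zero_mem' := rfl
  add_mem' := by
    intro a b ha hb
    change a.1.value 1 + b.1.value 1 = a.2.2.1.value 0 + b.2.2.1.value 0
    rw [show a.1.value 1 = a.2.2.1.value 0 from ha, show b.1.value 1 = b.2.2.1.value 0 from hb]
  smul_mem' := by
    intro r a ha
    change r * a.1.value 1 = r * a.2.2.1.value 0
    rw [show a.1.value 1 = a.2.2.1.value 0 from ha]

theorem energySpace_isClosed : IsClosed (energySpace : Set (H1 × L2 × H1 × L2)) := by
  have hc : ∀ x : unitInterval, Continuous fun f : H1 => f.value x := fun x =>
    (continuous_eval_const x).comp (continuous_fst.comp continuous_subtype_val)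
  exact isClosed_eq ((hc 1).comp continuous_fst)
    ((hc 0).comp (continuous_fst.comp (continuous_snd.comp continuous_snd)))

/-- Points `(u, u_t, v, v_t)` of `𝓗`, with the norm of the product. -/
def State : Type := energySpace

instance : NormedAddCommGroup State := inferInstanceAs (NormedAddCommGroup energySpace)

instance : NormedSpace ℝ State := inferInstanceAs (NormedSpace ℝ energySpace)

instance : CompleteSpace State :=
  have h : CompleteSpace energySpace := energySpace_isClosed.completeSpace_coe
  h

def State.u (X : State) : H1 := X.1.1
def State.ut (X : State) : L2 := X.1.2.1
def State.v (X : State) : H1 := X.1.2.2.1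
def State.vt (X : State) : L2 := X.1.2.2.2

/-! ### The closed loop

```
u_tt = c₁² u_xx,   u_x(0,t) = g u_t(0,t),   u(1,t) = v(0,t),
v_tt = c₂² v_xx,   v_x(0,t) = u_x(1,t),     v_x(1,t) = -h v_t(1,t) - q v(1,t)
```
written as `X' = A X` in `𝓗`, with `A (u, p, v, r) = (p, c₁² u_xx, r, c₂² v_xx)` on the domain
of all `(u, p, v, r) ∈ 𝓗` with `u, v ∈ H²`, `p, r ∈ H¹`, `p(1) = r(0)`, `u_x(0) = g p(0)`,
`v_x(0) = u_x(1)` and `v_x(1) = -h r(1) - q v(1)`. -/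

/-- `Y` lies in the domain of the operator `A` and `A Y = Z`. Here `a = u_x` and `b = v_x` are the
derivatives of the position components of `Y`, and `Z.u`, `Z.v` are the `H¹` functions in its
velocity components. -/
def IsImageUnderA (c₁ g c₂ h q : ℝ) (Y Z : State) : Prop :=
  Z.u.Represents Y.ut ∧ Z.v.Represents Y.vt ∧
  ∃ a b : H1,
    a.Represents Y.u.dx ∧ b.Represents Y.v.dx ∧
    Z.ut = c₁ ^ 2 • a.dx ∧ Z.vt = c₂ ^ 2 • b.dx ∧
    a.value 0 = g * Z.u.value 0 ∧
    b.value 0 = a.value 1 ∧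
    b.value 1 = -h * Z.v.value 1 - q * Y.v.value 1

/-- `X : [0,∞) → 𝓗` is the (mild) solution of the closed loop with initial condition `X₀ ∈ 𝓗`:
it is continuous and, for all `t ≥ 0`, `∫₀ᵗ X(s) ds` is in the domain of `A` and
`X(t) - X₀ = A ∫₀ᵗ X(s) ds`. -/
def IsSolution (c₁ g c₂ h q : ℝ) (X₀ : State) (X : ℝ≥0 → State) : Prop :=
  X 0 = X₀ ∧ Continuous X ∧
  ∀ t : ℝ≥0, IsImageUnderA c₁ g c₂ h q (∫ s in (0 : ℝ)..t, X s.toNNReal) (X t - X₀)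

/-- The seminorm `‖(u, u_t, v, v_t)‖_𝓗`, where
`‖(u, u_t, v, v_t)‖_𝓗² = c₁² ‖u_x‖² + ‖u_t‖² + c₂² ‖v_x‖² + ‖v_t‖²`. -/
def energySeminorm (c₁ c₂ : ℝ) (X : State) : ℝ :=
  Real.sqrt (c₁ ^ 2 * ‖X.u.dx‖ ^ 2 + ‖X.ut‖ ^ 2 + c₂ ^ 2 * ‖X.v.dx‖ ^ 2 + ‖X.vt‖ ^ 2)

/-- `𝓗`-exponential stability of a solution. -/
def IsExpStable (c₁ c₂ : ℝ) (X : ℝ≥0 → State) : Prop :=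
  ∃ γ : ℝ, 1 < γ ∧ ∃ α : ℝ, 0 < α ∧ ∀ t : ℝ≥0,
    energySeminorm c₁ c₂ (X t) ≤ γ * energySeminorm c₁ c₂ (X 0) * Real.exp (-α * t)

/-! ### The matrix inequalities -/

section Matrices

open Matrix

def matH (c₁ z c₂ h q : ℝ) : Matrix (Fin 4) (Fin 5) ℝ :=
  !![0,     c₁,  1, 0,          0;
     1 - z, 0,   0, 0,          0;
     0,     0,   0, 1 - c₂ * h, -c₂ * q;
     0,     -c₂, 1, 0,          0]

def matG (c₁ z c₂ h q : ℝ) : Matrix (Fin 4) (Fin 5) ℝ :=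
  !![1 + z, 0,   0, 0,          0;
     0,     -c₁, 1, 0,          0;
     0,     c₂,  1, 0,          0;
     0,     0,   0, 1 + c₂ * h, c₂ * q]

def matS (S₁ S₂ S₃ S₄ : ℝ) : Matrix (Fin 4) (Fin 4) ℝ := diagonal ![S₁, S₂, S₃, S₄]

def matE (c₁ c₂ α x : ℝ) : Matrix (Fin 4) (Fin 4) ℝ :=
  diagonal ![Real.exp (2 * α * x * c₁⁻¹), Real.exp (2 * α * x * c₁⁻¹),
    Real.exp (2 * α * x * c₂⁻¹), Real.exp (2 * α * x * c₂⁻¹)]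

def matQ (S₅ α : ℝ) : Matrix (Fin 5) (Fin 5) ℝ :=
  !![0, 0, 0, 0,  0;
     0, 0, 0, 0,  0;
     0, 0, 0, 0,  0;
     0, 0, 0, 0,  S₅;
     0, 0, 0, S₅, 2 * α * S₅]

/-- `Ψ_{c₁,z}(α) = Hᵀ E_α(1) S H - Gᵀ S G + Q_α`. -/
def matPsi (c₂ h q S₁ S₂ S₃ S₄ S₅ α c₁ z : ℝ) : Matrix (Fin 5) (Fin 5) ℝ :=
  (matH c₁ z c₂ h q)ᵀ * matE c₁ c₂ α 1 * matS S₁ S₂ S₃ S₄ * matH c₁ z c₂ h q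
    - (matG c₁ z c₂ h q)ᵀ * matS S₁ S₂ S₃ S₄ * matG c₁ z c₂ h q + matQ S₅ α

/-- `Ψ̃_{c₁,z} = [I₄ 0] Ψ_{c₁,z}(0) [I₄ 0]ᵀ`, the upper left `4 × 4` block of `Ψ_{c₁,z}(0)`. It
does not depend on `q` and `S₅`. -/
def matPsiTilde (c₂ h q S₁ S₂ S₃ S₄ S₅ c₁ z : ℝ) : Matrix (Fin 4) (Fin 4) ℝ :=
  (matPsi c₂ h q S₁ S₂ S₃ S₄ S₅ 0 c₁ z).submatrix Fin.castSucc Fin.castSucc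

/-- `M ≺ 0`. -/
def IsNegDef {n : ℕ} (M : Matrix (Fin n) (Fin n) ℝ) : Prop := (-M).PosDef

end Matrices

/-! ### The uncertainty set -/

/-- `𝓓 = {c₁ g : c₁ ∈ [c_min, c_max], g ∈ [g_min, g_max]}`. -/
def uncertaintySet (cmin cmax gmin gmax : ℝ) : Set ℝ :=
  {z | ∃ c ∈ Icc cmin cmax, ∃ g ∈ Icc gmin gmax, z = c * g}

/-- `|(1 - z) / (1 + z)|`, with the value `∞` at `z = -1`. -/
def reflection (z : ℝ) : ℝ≥0∞ := ENNReal.ofReal |1 - z| / ENNReal.ofReal |1 + z|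

/-- `δ_max = max_{z ∈ 𝓓} |(1 - z) / (1 + z)|`. -/
def deltaMax (cmin cmax gmin gmax : ℝ) : ℝ≥0∞ :=
  ⨆ z ∈ uncertaintySet cmin cmax gmin gmax, reflection z

end

end StringLoop

open Filter Topology

/-! The matrix inequalities are energy balances at the ends of the strings and at the joint: in the
Riemann coordinates `u_t ± c₁ u_x`, `v_t ± c₂ v_x`, the rows of `matH` are the waves entering the
strings and those of `matG` the waves leaving them. Since `δ_max ≥ 1`, the first diagonal entry
forces `S₂ < S₁`. The third then gives `S₄ < S₃`, which contradicts the fifth entry of `Ψ`; so only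
the alternative `q = 0` survives. There the two vertices suffice: the reflection at the left end is
worst at `zmax`, and the joint condition is convex in `c₁` because `S₂ < S₁`
(`boundary_dissipation_of_negDef`). Strictness leaves a margin `ε` (`exists_boundaryMargin`).

For `q = 0` the positions enter only through their derivatives, and the loop becomes an evolution of
`(u_x, u_t, v_x, v_t)` in a Hilbert space. The stationary problem is solved by integrating from the
left end. It is uniquely solvable because `g + h ≠ 0`, which also follows from the boundary
balances. Its bounded solution operator `T = statOp` is injective and plays the role of the inverse
generator, so a mild solution is a continuous `W` with `T (W t - W 0) = ∫₀ᵗ W`.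

The Lyapunov form `B` weights each Riemann coordinate by `1 + ε x` or `1 + ε - ε x`, increasing
against its direction of transport. Integration by parts and the margin give `B (T f) f ≤ -α B (T f)
(T f)` (`lyapunovForm_stat_le`). For any such `T` this yields decay (`IsMildSolution.energy_le`),
hence uniqueness, and by Yosida approximation existence (`exists_isMildSolution`). Finally `u` and
`v` are recovered from the energy vector and the initial state. -/

namespace StringLoop

noncomputable section

/-! ### Mild solutions: energy estimate, limits, resolvent and density of the range -/

section MildSolutions

variable {E : Type*} [NormedAddCommGroup E]

section Banach

variable [NormedSpace ℝ E]

/-- `W` is a mild solution on `[0,∞)` of `W' = T⁻¹ W`: it is continuous and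
`T (W t - W 0) = ∫₀ᵗ W` for `t ≥ 0`. -/
def IsMildSolution (T : E →L[ℝ] E) (W : ℝ → E) : Prop :=
  Continuous W ∧ ∀ t, 0 ≤ t → T (W t - W 0) = ∫ s in (0 : ℝ)..t, W s

theorem IsMildSolution.sub [CompleteSpace E] {T : E →L[ℝ] E} {V W : ℝ → E}
    (hV : IsMildSolution T V) (hW : IsMildSolution T W) :
    IsMildSolution T fun t => V t - W t := by
  refine ⟨hV.1.sub hW.1, fun t ht => ?_⟩
  rw [intervalIntegral.integral_sub (hV.1.intervalIntegrable _ _) (hW.1.intervalIntegrable _ _),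
    ← hV.2 t ht, ← hW.2 t ht, ← map_sub]
  change T (V t - W t - (V 0 - W 0)) = _
  congr 1
  abel

theorem hasDerivAt_integral_window [CompleteSpace E] {W : ℝ → E} (hW : Continuous W) (ε t : ℝ) :
    HasDerivAt (fun t => ∫ s in t..(t + ε), W s) (W (t + ε) - W t) t := by
  have h1 : ∀ t, ∫ s in t..(t + ε), W s = (∫ s in (0 : ℝ)..(t + ε), W s) - ∫ s in (0 : ℝ)..t, W s :=
    fun t => (intervalIntegral.integral_interval_sub_left (hW.intervalIntegrable _ _)
      (hW.intervalIntegrable _ _)).symm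
  simp_rw [h1]
  have h2 : ∀ x, HasDerivAt (fun t => ∫ s in (0 : ℝ)..t, W s) (W x) x := fun x =>
    intervalIntegral.integral_hasDerivAt_right (hW.intervalIntegrable _ _)
      (hW.stronglyMeasurableAtFilter _ _) hW.continuousAt
  exact ((h2 (t + ε)).comp_add_const t ε).sub (h2 t)

/-- The energy estimate for mild solutions; no regularity of the initial value is needed, since
the estimate holds for the averages `∫ₜᵗ⁺ᵉ W`. -/
theorem IsMildSolution.energy_le [CompleteSpace E] {T : E →L[ℝ] E} {W : ℝ → E}
    (hW : IsMildSolution T W) {B : E →L[ℝ] E →L[ℝ] ℝ} (hsymm : ∀ x y, B x y = B y x) {α : ℝ}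
    (hB : ∀ f, B (T f) f ≤ -α * B (T f) (T f)) {t : ℝ} (ht : 0 ≤ t) :
    B (W t) (W t) ≤ Real.exp (-(2 * α * t)) * B (W 0) (W 0) := by
  have key : ∀ ε : ℝ, 0 < ε →
      B (∫ s in t..(t + ε), W s) (∫ s in t..(t + ε), W s) ≤
        Real.exp (-(2 * α * t)) * B (∫ s in (0 : ℝ)..(0 + ε), W s) (∫ s in (0 : ℝ)..(0 + ε), W s) := by
    intro ε hε
    set U : ℝ → E := fun t => ∫ s in t..(t + ε), W s with hU
    have hd : ∀ x, HasDerivAt U (W (x + ε) - W x) x := hasDerivAt_integral_window hW.1 ε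
    -- The average is differentiable with `T U' = U`, so `hB` at `f = U'` bounds `B U U'` by `-α * B
    -- U U`.
    have hTU : ∀ x, 0 ≤ x → T (W (x + ε) - W x) = U x := by
      intro x hx
      have : W (x + ε) - W x = (W (x + ε) - W 0) - (W x - W 0) := by abel
      rw [this, map_sub, hW.2 _ (by linarith), hW.2 _ hx]
      exact intervalIntegral.integral_interval_sub_left (hW.1.intervalIntegrable _ _)
        (hW.1.intervalIntegrable _ _)
    have hBd : ∀ x, HasDerivAt (fun x => Real.exp (2 * α * x) * B (U x) (U x))
        (Real.exp (2 * α * x) * (2 * α) * B (U x) (U x) + Real.exp (2 * α * x) *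
          (B (W (x + ε) - W x) (U x) + B (U x) (W (x + ε) - W x))) x := by
      intro x
      have h1 : HasDerivAt (fun x => Real.exp (2 * α * x)) (Real.exp (2 * α * x) * (2 * α)) x := by
        simpa using ((hasDerivAt_id x).const_mul (2 * α)).exp
      have h2 := (B.hasFDerivAt.comp_hasDerivAt x (hd x)).clm_apply (hd x)
      exact h1.mul h2
    have hanti : AntitoneOn (fun x => Real.exp (2 * α * x) * B (U x) (U x)) (Ici 0) := by
      refine antitoneOn_of_deriv_nonpos (convex_Ici 0)
        (fun x _ => (hBd x).continuousAt.continuousWithinAt)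
        (fun x _ => (hBd x).differentiableAt.differentiableWithinAt) fun x hx => ?_
      rw [interior_Ici] at hx
      rw [(hBd x).deriv]
      have h := hB (W (x + ε) - W x)
      rw [hTU x hx.le] at h
      rw [hsymm (W (x + ε) - W x)]
      nlinarith [Real.exp_pos (2 * α * x)]
    have h := hanti (self_mem_Ici) ht ht
    simp only [mul_zero, Real.exp_zero, one_mul] at h
    rw [Real.exp_neg, ← div_eq_inv_mul, le_div_iff₀ (Real.exp_pos _), mul_comm]
    exact h
  -- Both sides of `key` are quadratic in the averages, so they can be rescaled by `ε⁻¹` before `ε →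
  -- 0`.
  have hlim : ∀ x, Tendsto (fun ε : ℝ => ε⁻¹ • ∫ s in x..(x + ε), W s) (𝓝[>] 0) (𝓝 (W x)) := by
    intro x
    have h2 : HasDerivAt (fun t => ∫ s in x..t, W s) (W x) x :=
      intervalIntegral.integral_hasDerivAt_right (hW.1.intervalIntegrable _ _)
        (hW.1.stronglyMeasurableAtFilter _ _) hW.1.continuousAt
    simpa using (hasDerivAt_iff_tendsto_slope_zero.1 h2).mono_left
      (nhdsWithin_mono (0 : ℝ) (s := Ioi 0) fun y (hy : 0 < y) => hy.ne')
  have hcont : Continuous fun x : E => B x x := by fun_prop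
  have hl := fun x => (hcont.tendsto (W x)).comp (hlim x)
  refine le_of_tendsto_of_tendsto (hl t) ((hl 0).const_mul _) ?_
  filter_upwards [self_mem_nhdsWithin] with ε hε
  have := key ε hε
  simp only [Function.comp_apply, map_smul, smul_apply, smul_eq_mul]
  have he : 0 ≤ ε⁻¹ * ε⁻¹ := mul_self_nonneg _
  nlinarith [mul_le_mul_of_nonneg_left this he]

/-- The bound `hC` makes the convergence uniform on bounded time intervals. This keeps continuity
and passes to the limit in the integral, while `T` is bounded. It serves both for approximating the
generator and for approximating the initial value. -/
theorem exists_isMildSolution_of_approx [CompleteSpace E] {T : E →L[ℝ] E} {W : ℕ → ℝ → E}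
    (hW : ∀ n, Continuous (W n)) {d : ℕ → ℝ} (hd : Tendsto d atTop (𝓝 0))
    (hC : ∀ n m t, ‖W n t - W m t‖ ≤ (1 + |t|) * (d n + d m))
    (hT : ∀ t, 0 ≤ t →
      Tendsto (fun n => T (W n t - W n 0) - ∫ s in (0 : ℝ)..t, W n s) atTop (𝓝 0)) :
    ∃ V, IsMildSolution T V ∧ Tendsto (fun n => W n 0) atTop (𝓝 (V 0)) := by
  have hcau : ∀ t, ∃ y, Tendsto (fun n => W n t) atTop (𝓝 y) := by
    intro t
    refine cauchySeq_tendsto_of_complete (Metric.cauchySeq_iff'.2 fun ε hε => ?_)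
    have h1 : Tendsto (fun n => (1 + |t|) * d n) atTop (𝓝 0) := by simpa using hd.const_mul _
    obtain ⟨N, hN⟩ := eventually_atTop.1 (h1.eventually_lt_const (half_pos hε))
    refine ⟨N, fun n hn => ?_⟩
    rw [dist_eq_norm]
    have := hC n N t
    have := hN n hn
    have := hN N le_rfl
    linarith
  choose V hV using hcau
  have hlim : ∀ n t, ‖W n t - V t‖ ≤ (1 + |t|) * d n := by
    intro n t
    have h1 : Tendsto (fun m => ‖W n t - W m t‖) atTop (𝓝 ‖W n t - V t‖) :=
      ((hV t).const_sub _).norm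
    have h2 : Tendsto (fun m => (1 + |t|) * (d n + d m)) atTop (𝓝 ((1 + |t|) * (d n + 0))) :=
      (hd.const_add _).const_mul _
    simpa using le_of_tendsto_of_tendsto' h1 h2 fun m => hC n m t
  have hunif : ∀ R : ℝ, TendstoUniformlyOn W V atTop (Icc (-R) R) := by
    intro R
    rw [Metric.tendstoUniformlyOn_iff]
    intro ε hε
    have h1 : Tendsto (fun n => (1 + R) * |d n|) atTop (𝓝 0) := by
      simpa using hd.abs.const_mul (1 + R)
    filter_upwards [h1.eventually_lt_const hε] with n hn t ht
    rw [dist_comm, dist_eq_norm]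
    have h2 : |t| ≤ R := abs_le.2 ht
    calc ‖W n t - V t‖ ≤ (1 + |t|) * d n := hlim n t
      _ ≤ (1 + |t|) * |d n| := by gcongr; exact le_abs_self _
      _ ≤ (1 + R) * |d n| := by gcongr
      _ < ε := hn
  have hVc : Continuous V := by
    have h1 : TendstoLocallyUniformly W V atTop := by
      rw [tendstoLocallyUniformly_iff_forall_isCompact]
      intro K hK
      obtain ⟨R, hR⟩ := hK.isBounded.subset_closedBall 0
      rw [Real.closedBall_eq_Icc, zero_sub, zero_add] at hR
      exact (hunif R).mono hR
    exact h1.continuous (Frequently.of_forall hW)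
  refine ⟨V, ⟨hVc, fun t ht => ?_⟩, hV 0⟩
  have h1 : Tendsto (fun n => ∫ s in (0 : ℝ)..t, W n s) atTop (𝓝 (∫ s in (0 : ℝ)..t, V s)) := by
    refine TendstoUniformlyOn.tendsto_intervalIntegral_of_continuousOn
      (Eventually.of_forall fun n => (hW n).continuousOn) ((hunif t).mono ?_)
    rw [uIcc_of_le ht]
    exact Icc_subset_Icc_left (by linarith)
  have h2 : Tendsto (fun n => T (W n t - W n 0)) atTop (𝓝 (T (V t - V 0))) :=
    (T.continuous.tendsto _).comp ((hV t).sub (hV 0))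
  exact sub_eq_zero.1 (tendsto_nhds_unique (h2.sub h1) (hT t ht))

/-- Coercivity below and boundedness above turn contractivity in `B` into norm bounds with one
uniform constant. -/
theorem exists_norm_le_of_form_le {B : E →L[ℝ] E →L[ℝ] ℝ} (hB : IsCoercive B) :
    ∃ M : ℝ, 0 ≤ M ∧ ∀ x y, B x x ≤ B y y → ‖x‖ ≤ M * ‖y‖ := by
  obtain ⟨c, hc, h⟩ := hB
  refine ⟨√(‖B‖ / c), Real.sqrt_nonneg _, fun x y hxy => ?_⟩
  have h1 : B y y ≤ ‖B‖ * ‖y‖ * ‖y‖ := (le_abs_self _).trans (B.le_opNorm₂ y y)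
  refine abs_le_of_sq_le_sq' ?_ (by positivity) |>.2
  rw [mul_pow, Real.sq_sqrt (by positivity), div_mul_eq_mul_div, le_div_iff₀ hc]
  nlinarith [h x]

end Banach

section Hilbert

variable [InnerProductSpace ℝ E] [CompleteSpace E]

/-- The inverse of `T - δ`, for `T` dissipative with respect to `B`. -/
theorem exists_inverse_sub_smul {B : E →L[ℝ] E →L[ℝ] ℝ} (hB : IsCoercive B) {T : E →L[ℝ] E}
    (hT : ∀ f, B (T f) f ≤ 0) {δ : ℝ} (hδ : 0 < δ) :
    ∃ A : E →L[ℝ] E, (∀ x, T (A x) - δ • A x = x) ∧ ∀ x, A (T x - δ • x) = x := by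
  -- Lax–Milgram for `(x, y) ↦ B ((δ - T) x) y`; by `hL` below, its operator is that of `B` composed
  -- with `δ - T`.
  have hC : IsCoercive (B ∘L (δ • ContinuousLinearMap.id ℝ E - T)) := by
    obtain ⟨c, hc, h⟩ := hB
    refine ⟨δ * c, mul_pos hδ hc, fun u => ?_⟩
    have h1 := h u
    have h2 := hT u
    simp only [ContinuousLinearMap.comp_apply, sub_apply, map_sub, smul_apply, map_smul,
      ContinuousLinearMap.id_apply, smul_eq_mul]
    nlinarith
  set L := hC.continuousLinearEquivOfBilin
  set L₀ := hB.continuousLinearEquivOfBilin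
  have hL : ∀ v, L v = L₀ (δ • v - T v) := by
    intro v
    refine ext_inner_right ℝ fun w => ?_
    simp [L, L₀, inner_sub_left, inner_smul_left]
  refine ⟨-((L.symm : E →L[ℝ] E) ∘L (L₀ : E →L[ℝ] E)), fun x => ?_, fun x => ?_⟩
  · apply L₀.injective
    have h := hL (L.symm (L₀ x))
    rw [L.apply_symm_apply] at h
    rw [h]
    congr 1
    simp only [neg_apply, ContinuousLinearMap.comp_apply, ContinuousLinearEquiv.coe_coe, map_neg,
      smul_neg]
    abel
  · have h := hL x
    have h2 : T x - δ • x = -(δ • x - T x) := by abel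
    rw [h2, map_neg]
    simp only [neg_apply, ContinuousLinearMap.comp_apply, ContinuousLinearEquiv.coe_coe, neg_neg]
    rw [← h, L.symm_apply_apply]

/-- A vector orthogonal to the range corresponds to some `w` that is `B`-orthogonal to it.
Dissipativity at `w + s • T w` then loses its zeroth order term, and small `s > 0` forces `T w = 0`.
-/
theorem denseRange_of_dissipative {B : E →L[ℝ] E →L[ℝ] ℝ} (hB : IsCoercive B)
    (hsymm : ∀ x y, B x y = B y x) {T : E →L[ℝ] E} (hT : ∀ f, B (T f) f ≤ 0)
    (hinj : ∀ f, T f = 0 → f = 0) : DenseRange T := by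
  have h1 : T.range.topologicalClosure = ⊤ := by
    rw [Submodule.topologicalClosure_eq_top_iff, Submodule.eq_bot_iff]
    intro y hy
    set L := hB.continuousLinearEquivOfBilin
    obtain ⟨w, rfl⟩ : ∃ w, L w = y := L.surjective y
    have hw : ∀ f, B w (T f) = 0 := by
      intro f
      have := (Submodule.mem_orthogonal' _ _).1 hy (T f) ⟨f, rfl⟩
      simpa [L] using this
    have h2 : ∀ s : ℝ, s * B (T w) (T w) + s ^ 2 * B (T (T w)) (T w) ≤ 0 := by
      intro s
      have h := hT (w + s • T w)
      simp only [map_add, map_smul, add_apply, smul_apply, smul_eq_mul] at h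
      have h3 := hw w
      have h4 := hw (T w)
      rw [hsymm] at h3 h4
      rw [h3, h4] at h
      linarith
    have h3 := hT (T w)
    have h4 : T w = 0 := by
      obtain ⟨c, hc, hcB⟩ := hB
      have h5 : B (T w) (T w) ≤ 0 := by
        by_contra! hpos
        -- This `s` makes the left side of `h2` equal to `s ^ 2`, which is positive.
        have h6 := h2 (B (T w) (T w) / (1 - B (T (T w)) (T w)))
        have h7 : 0 < 1 - B (T (T w)) (T w) := by linarith
        have h8 : B (T w) (T w) / (1 - B (T (T w)) (T w)) * B (T w) (T w) +
            (B (T w) (T w) / (1 - B (T (T w)) (T w))) ^ 2 * B (T (T w)) (T w) =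
            (B (T w) (T w) / (1 - B (T (T w)) (T w))) ^ 2 := by
          field_simp
          ring
        rw [h8] at h6
        have : 0 < B (T w) (T w) / (1 - B (T (T w)) (T w)) := by positivity
        nlinarith
      have h6 := hcB (T w)
      have h7 : ‖T w‖ * ‖T w‖ ≤ 0 := by nlinarith
      rw [← norm_eq_zero]
      nlinarith [norm_nonneg (T w)]
    rw [hinj w h4, map_zero]
  rw [DenseRange, dense_iff_closure_eq]
  exact congrArg (fun K : Submodule ℝ E => (K : Set E)) h1

end Hilbert

end MildSolutions

/-! ### Existence and uniqueness of mild solutions by Yosida approximation -/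

section Existence

variable {E : Type*} [NormedAddCommGroup E]

section Banach

variable [NormedSpace ℝ E] [CompleteSpace E]

theorem hasDerivAt_exp_smul_apply (A : E →L[ℝ] E) (x : E) (t : ℝ) :
    HasDerivAt (fun t : ℝ => NormedSpace.exp (t • A) x) (A (NormedSpace.exp (t • A) x)) t :=
  (ContinuousLinearMap.apply ℝ E x).hasFDerivAt.comp_hasDerivAt t
    (hasDerivAt_exp_smul_const' (𝕂 := ℝ) A t)

/-- The exponential of a dissipative operator is contractive. -/
theorem form_exp_smul_le {B : E →L[ℝ] E →L[ℝ] ℝ} (hsymm : ∀ x y, B x y = B y x)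
    {A : E →L[ℝ] E} (hA : ∀ x, B (A x) x ≤ 0) (x : E) {t : ℝ} (ht : 0 ≤ t) :
    B (NormedSpace.exp (t • A) x) (NormedSpace.exp (t • A) x) ≤ B x x := by
  have hd : ∀ s, HasDerivAt
      (fun s : ℝ => B (NormedSpace.exp (s • A) x) (NormedSpace.exp (s • A) x)) _ s := fun s =>
    (B.hasFDerivAt.comp_hasDerivAt s (hasDerivAt_exp_smul_apply A x s)).clm_apply
      (hasDerivAt_exp_smul_apply A x s)
  have hanti := antitone_of_hasDerivAt_nonpos hd fun s => by
    change B (A (NormedSpace.exp (s • A) x)) (NormedSpace.exp (s • A) x) +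
      B (NormedSpace.exp (s • A) x) (A (NormedSpace.exp (s • A) x)) ≤ 0
    rw [hsymm (NormedSpace.exp (s • A) x)]
    have := hA (NormedSpace.exp (s • A) x)
    linarith
  simpa using hanti ht

/-- The path `s ↦ exp ((t - s) C) exp (s A) x` joins the two vectors, and by commutation its
derivative is `exp ((t - s) C) exp (s A) (A x - C x)`. -/
theorem norm_exp_smul_sub_le {A C : E →L[ℝ] E} (hAC : Commute A C) {M : ℝ} (hM : 0 ≤ M)
    (hA : ∀ x t, 0 ≤ t → ‖NormedSpace.exp ((t : ℝ) • A) x‖ ≤ M * ‖x‖)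
    (hC : ∀ x t, 0 ≤ t → ‖NormedSpace.exp ((t : ℝ) • C) x‖ ≤ M * ‖x‖) (x : E) {t : ℝ}
    (ht : 0 ≤ t) :
    ‖NormedSpace.exp (t • A) x - NormedSpace.exp (t • C) x‖ ≤ M * (M * ‖A x - C x‖) * t := by
  have hd : ∀ s, HasDerivAt
      (fun s : ℝ => NormedSpace.exp ((t - s) • C) (NormedSpace.exp (s • A) x))
      (NormedSpace.exp ((t - s) • C) (NormedSpace.exp (s • A) (A x - C x))) s := by
    intro s
    have h1 : HasDerivAt (fun s : ℝ => NormedSpace.exp ((t - s) • C))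
        (-(NormedSpace.exp ((t - s) • C) * C)) s := by
      have h := (hasDerivAt_exp_smul_const (𝕂 := ℝ) C (t - s)).scomp s
        ((hasDerivAt_id s).const_sub t)
      rw [neg_one_smul] at h
      exact h
    have h2 := h1.clm_apply ((ContinuousLinearMap.apply ℝ E x).hasFDerivAt.comp_hasDerivAt s
      (hasDerivAt_exp_smul_const (𝕂 := ℝ) A s))
    have h3 : Commute C (NormedSpace.exp (s • A)) := (hAC.symm.smul_right s).exp_right
    refine h2.congr_deriv ?_
    have h4 : C (NormedSpace.exp (s • A) x) = NormedSpace.exp (s • A) (C x) :=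
      DFunLike.congr_fun h3.eq x
    change -(NormedSpace.exp ((t - s) • C) (C (NormedSpace.exp (s • A) x))) +
      NormedSpace.exp ((t - s) • C) (NormedSpace.exp (s • A) (A x)) = _
    rw [h4, map_sub, map_sub]
    abel
  have h := norm_image_sub_le_of_norm_deriv_le_segment' (a := 0) (b := t)
    (fun s _ => (hd s).hasDerivWithinAt) (C := M * (M * ‖A x - C x‖)) (fun s hs =>
      (hC _ _ (by linarith [hs.2])).trans (by gcongr; exact hA _ _ hs.1)) t (right_mem_Icc.2 ht)
  simpa using h

end Banach

section Hilbert

variable [InnerProductSpace ℝ E] [CompleteSpace E]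

/-- With `G = T⁻¹` formally, `(T - δ)⁻¹ = G (1 - δ G)⁻¹` is the Yosida approximation of `G`. Initial
values `T (T z)` correspond to the domain of `G²`, where the approximations converge at rate `δ`. -/
theorem exists_isMildSolution_of_range_sq {B : E →L[ℝ] E →L[ℝ] ℝ} (hB : IsCoercive B)
    (hsymm : ∀ x y, B x y = B y x) {T : E →L[ℝ] E} (hT : ∀ f, B (T f) f ≤ 0) (z : E) :
    ∃ W, IsMildSolution T W ∧ W 0 = T (T z) := by
  have hnonneg : ∀ x, 0 ≤ B x x := by
    obtain ⟨c, hc, h⟩ := hB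
    exact fun x => le_trans (by positivity) (h x)
  obtain ⟨M, hM, hMB⟩ := exists_norm_le_of_form_le hB
  set δ : ℕ → ℝ := fun n => 1 / ((n : ℝ) + 1) with hδdef
  have hδ : ∀ n, 0 < δ n := fun n => by positivity
  have hδ0 : Tendsto δ atTop (𝓝 0) := tendsto_one_div_add_atTop_nhds_zero_nat
  choose A hTA hAT using fun n => exists_inverse_sub_smul hB hT (hδ n)
  have hAT' : ∀ n x, A n (T x) = x + δ n • A n x := by
    intro n x
    have := hAT n x
    rw [map_sub, map_smul, sub_eq_iff_eq_add] at this
    exact this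
  have hTA' : ∀ n x, T (A n x) = x + δ n • A n x := fun n x => sub_eq_iff_eq_add.1 (hTA n x)
  have hdiss : ∀ n x, B (A n x) x ≤ 0 := by
    intro n x
    have h1 : B (A n x) x = B (A n x) (T (A n x) - δ n • A n x) := by rw [hTA]
    rw [h1, map_sub, map_smul, smul_eq_mul, hsymm]
    nlinarith [hT (A n x), hnonneg (A n x), hδ n]
  have hcomm : ∀ n m, Commute (A n) (A m) := by
    intro n m
    refine ContinuousLinearMap.ext fun x => ?_
    change A n (A m x) = A m (A n x)
    conv_lhs => rw [← hTA n x]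
    rw [map_sub (A m), map_smul (A m), hAT', ← hTA', hAT]
  have hexp : ∀ n x t, 0 ≤ t → ‖NormedSpace.exp ((t : ℝ) • A n) x‖ ≤ M * ‖x‖ := fun n x t ht =>
    hMB _ _ (form_exp_smul_le hsymm (hdiss n) x ht)
  -- Expanding `B x x` with `x = T (A n x) - δ n • A n x`, every term other than `B (T (A n x)) (T
  -- (A n x))` is nonnegative.
  have hJ : ∀ n x, ‖T (A n x)‖ ≤ M * ‖x‖ := by
    intro n x
    refine hMB _ _ ?_
    have h1 : B x x = B (T (A n x) - δ n • A n x) (T (A n x) - δ n • A n x) := by rw [hTA]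
    rw [h1]
    simp only [map_sub, map_smul, sub_apply, smul_apply, smul_eq_mul]
    rw [hsymm (A n x) (T (A n x))]
    nlinarith [mul_nonneg (mul_self_nonneg (δ n)) (hnonneg (A n x)),
      mul_nonneg (hδ n).le (neg_nonneg.2 (hT (A n x)))]
  have hdiff : ∀ n m, ‖A n (T (T z)) - A m (T (T z))‖ ≤ (δ n + δ m) * (M * ‖z‖) := by
    intro n m
    have h1 : ∀ n, A n (T (T z)) = T z + δ n • T (A n z) := by
      intro n
      rw [hAT' n (T z), hAT' n z, ← hTA' n z]
    rw [h1, h1, add_sub_add_left_eq_sub]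
    refine (norm_sub_le _ _).trans ?_
    rw [norm_smul, norm_smul, Real.norm_of_nonneg (hδ n).le, Real.norm_of_nonneg (hδ m).le, add_mul]
    have := hδ n
    have := hδ m
    gcongr <;> exact hJ _ _
  have hcont : ∀ n, Continuous fun t : ℝ => NormedSpace.exp (t • A n) (T (T z)) := fun n =>
    continuous_iff_continuousAt.2 fun t => (hasDerivAt_exp_smul_apply _ _ t).continuousAt
  -- The exponentials are contractive only forwards in time, so the approximants are frozen for `t <
  -- 0`.
  have hcauchy : ∀ n m t, ‖NormedSpace.exp ((max t 0 : ℝ) • A n) (T (T z)) -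
      NormedSpace.exp ((max t 0 : ℝ) • A m) (T (T z))‖ ≤
      (1 + |t|) * (M * (M * (M * ‖z‖)) * δ n + M * (M * (M * ‖z‖)) * δ m) := by
    intro n m t
    have h1 := norm_exp_smul_sub_le (hcomm n m) hM (hexp n) (hexp m) (T (T z)) (le_max_right t 0)
    refine h1.trans ?_
    have h2 : max t 0 ≤ 1 + |t| := max_le (by linarith [le_abs_self t]) (by positivity)
    have := hδ n
    have := hδ m
    calc M * (M * ‖A n (T (T z)) - A m (T (T z))‖) * max t 0
        ≤ M * (M * ((δ n + δ m) * (M * ‖z‖))) * (1 + |t|) := by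
          gcongr
          exact hdiff n m
      _ = _ := by ring
  have hres : ∀ t : ℝ, 0 ≤ t → Tendsto (fun n => T (NormedSpace.exp ((max t 0) • A n) (T (T z)) -
      NormedSpace.exp ((max 0 0 : ℝ) • A n) (T (T z))) -
      ∫ s in (0 : ℝ)..t, NormedSpace.exp ((max s 0) • A n) (T (T z))) atTop (𝓝 0) := by
    intro t ht
    -- Since `T A n = 1 + δ n A n`, the integrated equation fails only by a term of order `δ n`.
    have h1 : ∀ n, T (NormedSpace.exp ((max t 0) • A n) (T (T z)) -
        NormedSpace.exp ((max 0 0 : ℝ) • A n) (T (T z))) -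
        ∫ s in (0 : ℝ)..t, NormedSpace.exp ((max s 0) • A n) (T (T z)) =
        δ n • (NormedSpace.exp (t • A n) (T (T z)) - T (T z)) := by
      intro n
      have h2 : ∀ s ∈ uIcc 0 t, HasDerivAt
          (fun s : ℝ => T (NormedSpace.exp (s • A n) (T (T z))) -
            δ n • NormedSpace.exp (s • A n) (T (T z)))
          (NormedSpace.exp (s • A n) (T (T z))) s := by
        intro s _
        have h3 := hasDerivAt_exp_smul_apply (A n) (T (T z)) s
        refine ((T.hasFDerivAt.comp_hasDerivAt s h3).sub (h3.const_smul (δ n))).congr_deriv ?_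
        exact hTA n _
      have h4 : ∫ s in (0 : ℝ)..t, NormedSpace.exp ((max s 0) • A n) (T (T z)) =
          ∫ s in (0 : ℝ)..t, NormedSpace.exp (s • A n) (T (T z)) := by
        refine intervalIntegral.integral_congr fun s hs => ?_
        rw [uIcc_of_le ht] at hs
        simp only [max_eq_left hs.1]
      rw [h4, intervalIntegral.integral_eq_sub_of_hasDerivAt h2 ((hcont n).intervalIntegrable _ _),
        max_eq_left ht, max_self]
      simp only [zero_smul, NormedSpace.exp_zero, one_apply_eq_self, map_sub, smul_sub]
      abel
    simp only [h1]
    refine squeeze_zero_norm (a := fun n => δ n * (M * ‖T (T z)‖ + ‖T (T z)‖)) (fun n => ?_)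
      (by simpa using hδ0.mul_const _)
    rw [norm_smul, Real.norm_of_nonneg (hδ n).le]
    have := hδ n
    gcongr
    exact (norm_sub_le _ _).trans (by gcongr; exact hexp n _ _ ht)
  obtain ⟨V, hV, hV0⟩ := exists_isMildSolution_of_approx
    (fun n => (hcont n).comp (continuous_id.max continuous_const))
    (by simpa using hδ0.const_mul (M * (M * (M * ‖z‖)))) hcauchy hres
  refine ⟨V, hV, ?_⟩
  simpa [eq_comm] using hV0

/-- For `T` injective and dissipative, `W' = T⁻¹ W` has a mild solution for every initial value. -/
theorem exists_isMildSolution {B : E →L[ℝ] E →L[ℝ] ℝ} (hB : IsCoercive B)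
    (hsymm : ∀ x y, B x y = B y x) {T : E →L[ℝ] E} (hT : ∀ f, B (T f) f ≤ 0)
    (hinj : ∀ f, T f = 0 → f = 0) (x : E) : ∃ W, IsMildSolution T W ∧ W 0 = x := by
  have hdense : DenseRange fun z => T (T z) :=
    (denseRange_of_dissipative hB hsymm hT hinj).comp (denseRange_of_dissipative hB hsymm hT hinj)
      T.continuous
  obtain ⟨M, hM, hMB⟩ := exists_norm_le_of_form_le hB
  obtain ⟨u, hu, hux⟩ := mem_closure_iff_seq_limit.1 (hdense x)
  have hW : ∀ n, ∃ W, IsMildSolution T W ∧ W 0 = u n := by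
    intro n
    obtain ⟨z, hz⟩ := hu n
    obtain ⟨W, hW, hW0⟩ := exists_isMildSolution_of_range_sq hB hsymm hT z
    exact ⟨W, hW, hW0.trans hz⟩
  choose W hW hW0 using hW
  have hd : Tendsto (fun n => M * ‖u n - x‖) atTop (𝓝 0) := by
    have h1 : Tendsto (fun n => M * ‖u n - x‖) atTop (𝓝 (M * ‖x - x‖)) :=
      ((hux.sub_const x).norm).const_mul M
    simpa using h1
  have hcauchy : ∀ n m t, ‖W n (max t 0) - W m (max t 0)‖ ≤
      (1 + |t|) * (M * ‖u n - x‖ + M * ‖u m - x‖) := by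
    intro n m t
    -- With `α = 0` the energy estimate is contractivity: solutions depend on initial values
    -- uniformly in time.
    have h1 := ((hW n).sub (hW m)).energy_le (α := 0) hsymm (by simpa using hT) (le_max_right t 0)
    have h2 := hMB _ (W n 0 - W m 0) (h1.trans (by simp))
    refine h2.trans ?_
    rw [hW0, hW0]
    have h3 : ‖u n - u m‖ ≤ ‖u n - x‖ + ‖u m - x‖ := by
      rw [norm_sub_rev (u m)]
      exact norm_sub_le_norm_sub_add_norm_sub _ _ _
    calc M * ‖u n - u m‖ ≤ 1 * (M * ‖u n - x‖ + M * ‖u m - x‖) := by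
          rw [one_mul, ← mul_add]; gcongr
      _ ≤ _ := by
        gcongr
        linarith [abs_nonneg t]
  have hres : ∀ t, 0 ≤ t → Tendsto (fun n => T (W n (max t 0) - W n (max 0 0)) -
      ∫ s in (0 : ℝ)..t, W n (max s 0)) atTop (𝓝 0) := by
    intro t ht
    have h1 : ∀ n, T (W n (max t 0) - W n (max 0 0)) - ∫ s in (0 : ℝ)..t, W n (max s 0) = 0 := by
      intro n
      rw [max_eq_left ht, max_self, (hW n).2 t ht, sub_eq_zero]
      refine intervalIntegral.integral_congr fun s hs => ?_
      rw [uIcc_of_le ht] at hs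
      simp only [max_eq_left hs.1]
    simp only [h1]
    exact tendsto_const_nhds
  obtain ⟨V, hV, hV0⟩ := exists_isMildSolution_of_approx
    (fun n => (hW n).1.comp (continuous_id.max continuous_const)) hd hcauchy hres
  refine ⟨V, hV, tendsto_nhds_unique hV0 ?_⟩
  simpa [hW0] using hux

theorem IsMildSolution.eq_of_dissipative {B : E →L[ℝ] E →L[ℝ] ℝ} (hB : IsCoercive B)
    (hsymm : ∀ x y, B x y = B y x) {T : E →L[ℝ] E} (hT : ∀ f, B (T f) f ≤ 0) {V W : ℝ → E}
    (hV : IsMildSolution T V) (hW : IsMildSolution T W) (h0 : V 0 = W 0) {t : ℝ} (ht : 0 ≤ t) :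
    V t = W t := by
  obtain ⟨M, hM, hMB⟩ := exists_norm_le_of_form_le hB
  have h1 := (hV.sub hW).energy_le (α := 0) hsymm (by simpa using hT) ht
  have h2 := hMB _ (V 0 - W 0) (h1.trans (by simp))
  rw [h0, sub_self, norm_zero, mul_zero] at h2
  exact sub_eq_zero.1 (norm_le_zero_iff.1 h2)

end Hilbert

end Existence

/-! ### The matrix inequalities as quadratic forms -/

section MatrixInequalities

open Matrix

theorem IsNegDef.dotProduct_neg {n : ℕ} {M : Matrix (Fin n) (Fin n) ℝ} (hM : IsNegDef M)
    {x : Fin n → ℝ} (hx : x ≠ 0) : x ⬝ᵥ (M *ᵥ x) < 0 := by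
  have h := hM.dotProduct_mulVec_pos hx
  simpa [neg_mulVec] using h

variable {c₁ z c₂ h q S₁ S₂ S₃ S₄ S₅ : ℝ}

/-- The variables stand for `u_t(0)`, the common slope and velocity at the joint, `v_t(1)` and
`v(1)`. The form decouples into `x₁`, `(x₂, x₃)` and `(x₄, x₅)`, one block per boundary point. -/
theorem matPsi_form (x₁ x₂ x₃ x₄ x₅ : ℝ) :
    ![x₁, x₂, x₃, x₄, x₅] ⬝ᵥ (matPsi c₂ h q S₁ S₂ S₃ S₄ S₅ 0 c₁ z *ᵥ ![x₁, x₂, x₃, x₄, x₅]) =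
      S₁ * (c₁ * x₂ + x₃) ^ 2 + S₂ * ((1 - z) * x₁) ^ 2
        + S₃ * ((1 - c₂ * h) * x₄ - c₂ * q * x₅) ^ 2 + S₄ * (x₃ - c₂ * x₂) ^ 2
        - (S₁ * ((1 + z) * x₁) ^ 2 + S₂ * (x₃ - c₁ * x₂) ^ 2 + S₃ * (x₃ + c₂ * x₂) ^ 2
          + S₄ * ((1 + c₂ * h) * x₄ + c₂ * q * x₅) ^ 2) + 2 * S₅ * x₄ * x₅ := by
  simp [matPsi, matH, matG, matS, matE, matQ, Fin.sum_univ_succ, dotProduct, mulVec, mul_apply,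
    diagonal_apply]
  ring

theorem matPsiTilde_form (x₁ x₂ x₃ x₄ : ℝ) :
    ![x₁, x₂, x₃, x₄] ⬝ᵥ (matPsiTilde c₂ h q S₁ S₂ S₃ S₄ S₅ c₁ z *ᵥ ![x₁, x₂, x₃, x₄]) =
      S₁ * (c₁ * x₂ + x₃) ^ 2 + S₂ * ((1 - z) * x₁) ^ 2
        + S₃ * ((1 - c₂ * h) * x₄) ^ 2 + S₄ * (x₃ - c₂ * x₂) ^ 2
        - (S₁ * ((1 + z) * x₁) ^ 2 + S₂ * (x₃ - c₁ * x₂) ^ 2 + S₃ * (x₃ + c₂ * x₂) ^ 2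
          + S₄ * ((1 + c₂ * h) * x₄) ^ 2) := by
  have h1 := matPsi_form (c₁ := c₁) (z := z) (c₂ := c₂) (h := h) (q := q) (S₁ := S₁) (S₂ := S₂)
    (S₃ := S₃) (S₄ := S₄) (S₅ := S₅) x₁ x₂ x₃ x₄ 0
  simp only [mul_zero, sub_zero, add_zero] at h1
  rw [← h1]
  simp [matPsiTilde, dotProduct, mulVec, Fin.sum_univ_succ, submatrix_apply, Fin.succ, Fin.castSucc]

end MatrixInequalities

/-! ### Comparison of reflection coefficients -/

section Reflection

theorem one_add_ne_zero_of_reflection_lt_top {z : ℝ} (hz : reflection z < ⊤) : 1 + z ≠ 0 := by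
  intro h0
  have h1 : z = -1 := by linarith
  rw [reflection, h0, h1, abs_zero, ENNReal.ofReal_zero, ENNReal.div_zero (by norm_num)] at hz
  exact lt_irrefl _ hz

theorem reflection_eq_ofReal {z : ℝ} (hz : 1 + z ≠ 0) :
    reflection z = ENNReal.ofReal (|1 - z| / |1 + z|) :=
  (ENNReal.ofReal_div_of_pos (abs_pos.2 hz)).symm

theorem sq_le_of_reflection_le {z w : ℝ} (hz : 1 + z ≠ 0) (hw : 1 + w ≠ 0)
    (h : reflection z ≤ reflection w) :
    (1 - z) ^ 2 * (1 + w) ^ 2 ≤ (1 - w) ^ 2 * (1 + z) ^ 2 := by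
  rw [reflection_eq_ofReal hz, reflection_eq_ofReal hw,
    ENNReal.ofReal_le_ofReal_iff (by positivity),
    div_le_div_iff₀ (abs_pos.2 hz) (abs_pos.2 hw), ← abs_mul, ← abs_mul] at h
  have := sq_le_sq.2 h
  nlinarith

theorem sq_le_of_one_le_reflection {z : ℝ} (hz : 1 + z ≠ 0) (h : 1 ≤ reflection z) :
    (1 + z) ^ 2 ≤ (1 - z) ^ 2 := by
  -- The bound `1` is itself the reflection at `z = 0`.
  have h0 : reflection 0 = 1 := by simp [reflection]
  have := sq_le_of_reflection_le (z := 0) (by norm_num) hz (h0.trans_le h)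
  simpa using this

end Reflection

/-! ### From strict boundary inequalities to a uniform margin -/

section Margin

/-- Convexity in `c`; `h3` is the chord inequality with its exact defect. -/
theorem quadratic_neg_of_endpoints {A B C l u c : ℝ} (hA : 0 ≤ A) (hc : c ∈ Icc l u)
    (hl : A * l ^ 2 + B * l + C < 0) (hu : A * u ^ 2 + B * u + C < 0) :
    A * c ^ 2 + B * c + C < 0 := by
  rcases eq_or_lt_of_le hc.1 with rfl | h1
  · exact hl
  rcases eq_or_lt_of_le hc.2 with rfl | h2
  · exact hu
  have h3 : (u - l) * (A * c ^ 2 + B * c + C) = (u - c) * (A * l ^ 2 + B * l + C) +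
      (c - l) * (A * u ^ 2 + B * u + C) - A * ((c - l) * (u - c) * (u - l)) := by ring
  have h4 : 0 ≤ A * ((c - l) * (u - c) * (u - l)) := by
    have := sub_pos.2 h1
    have := sub_pos.2 h2
    have := sub_pos.2 (h1.trans h2)
    positivity
  have h5 : (u - l) * (A * c ^ 2 + B * c + C) < 0 := by nlinarith
  exact neg_of_mul_neg_right h5 (by linarith)

/-- A positive definite binary form stays nonnegative under a small perturbation. -/
theorem eventually_binary_form_nonneg {p₁ p₂ p₃ r₁ r₂ r₃ : ℝ}
    (h : ∀ a b, (a, b) ≠ ((0 : ℝ), (0 : ℝ)) → 0 < p₁ * a ^ 2 + 2 * p₂ * a * b + p₃ * b ^ 2) :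
    ∀ᶠ ε in 𝓝 (0 : ℝ), ∀ a b,
      0 ≤ (p₁ - ε * r₁) * a ^ 2 + 2 * (p₂ - ε * r₂) * a * b + (p₃ - ε * r₃) * b ^ 2 := by
  have h1 : 0 < p₁ := by simpa using h 1 0 (by simp)
  have h2 : 0 < p₁ * p₃ - p₂ ^ 2 := by
    -- At this vector the form equals `p₁` times the determinant.
    have := h (-p₂) p₁ (by simp [h1.ne'])
    have h3 : 0 < p₁ * (p₁ * p₃ - p₂ ^ 2) := by nlinarith
    exact (mul_pos_iff_of_pos_left h1).1 h3
  have e1 : ∀ᶠ ε in 𝓝 (0 : ℝ), 0 < p₁ - ε * r₁ := by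
    refine ContinuousAt.eventually_lt (f := fun _ : ℝ => (0 : ℝ)) (by fun_prop) (by fun_prop) ?_
    simpa using h1
  have e2 : ∀ᶠ ε in 𝓝 (0 : ℝ), 0 < (p₁ - ε * r₁) * (p₃ - ε * r₃) - (p₂ - ε * r₂) ^ 2 := by
    refine ContinuousAt.eventually_lt (f := fun _ : ℝ => (0 : ℝ)) (by fun_prop) (by fun_prop) ?_
    simpa using h2
  filter_upwards [e1, e2] with ε he1 he2 a b
  have h3 : 0 ≤ (p₁ - ε * r₁) *
      ((p₁ - ε * r₁) * a ^ 2 + 2 * (p₂ - ε * r₂) * a * b + (p₃ - ε * r₃) * b ^ 2) := by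
    have : (p₁ - ε * r₁) *
      ((p₁ - ε * r₁) * a ^ 2 + 2 * (p₂ - ε * r₂) * a * b + (p₃ - ε * r₃) * b ^ 2) =
      ((p₁ - ε * r₁) * a + (p₂ - ε * r₂) * b) ^ 2 +
      ((p₁ - ε * r₁) * (p₃ - ε * r₃) - (p₂ - ε * r₂) ^ 2) * b ^ 2 := by ring
    rw [this]
    positivity
  exact nonneg_of_mul_nonneg_right h3 he1

/-- The boundary conditions of the closed loop with `q = 0` dissipate: at each of the three
boundary points the weighted energy entering the strings is at most `1 / (1 + ε)` times the
weighted energy leaving them. -/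
structure BoundaryMargin (c₁ g c₂ h S₁ S₂ S₃ S₄ ε : ℝ) : Prop where
  left : (1 + ε) * (S₂ * (1 - c₁ * g) ^ 2) ≤ S₁ * (1 + c₁ * g) ^ 2
  middle : ∀ a b, (1 + ε) * (S₁ * (b + c₁ * a) ^ 2 + S₄ * (b - c₂ * a) ^ 2) ≤
    S₂ * (b - c₁ * a) ^ 2 + S₃ * (b + c₂ * a) ^ 2
  right : (1 + ε) * (S₃ * (1 - c₂ * h) ^ 2) ≤ S₄ * (1 + c₂ * h) ^ 2

variable {c₁ g c₂ h S₁ S₂ S₃ S₄ : ℝ}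

theorem exists_boundaryMargin
    (hl : S₂ * (1 - c₁ * g) ^ 2 < S₁ * (1 + c₁ * g) ^ 2)
    (hm : ∀ a b, (a, b) ≠ ((0 : ℝ), (0 : ℝ)) → S₁ * (b + c₁ * a) ^ 2 + S₄ * (b - c₂ * a) ^ 2 <
      S₂ * (b - c₁ * a) ^ 2 + S₃ * (b + c₂ * a) ^ 2)
    (hr : S₃ * (1 - c₂ * h) ^ 2 < S₄ * (1 + c₂ * h) ^ 2) :
    ∃ ε, 0 < ε ∧ BoundaryMargin c₁ g c₂ h S₁ S₂ S₃ S₄ ε := by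
  have e1 : ∀ᶠ ε in 𝓝 (0 : ℝ), (1 + ε) * (S₂ * (1 - c₁ * g) ^ 2) < S₁ * (1 + c₁ * g) ^ 2 :=
    ContinuousAt.eventually_lt (by fun_prop) (by fun_prop) (by simpa using hl)
  have e2 : ∀ᶠ ε in 𝓝 (0 : ℝ), (1 + ε) * (S₃ * (1 - c₂ * h) ^ 2) < S₄ * (1 + c₂ * h) ^ 2 :=
    ContinuousAt.eventually_lt (by fun_prop) (by fun_prop) (by simpa using hr)
  -- The `p`'s are the coefficients of leaving minus entering energy at the joint, the `r`'s those
  -- of the entering energy.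
  have e3 := eventually_binary_form_nonneg
    (p₁ := S₂ * c₁ ^ 2 + S₃ * c₂ ^ 2 - S₁ * c₁ ^ 2 - S₄ * c₂ ^ 2)
    (p₂ := -S₂ * c₁ + S₃ * c₂ - S₁ * c₁ + S₄ * c₂) (p₃ := S₂ + S₃ - S₁ - S₄)
    (r₁ := S₁ * c₁ ^ 2 + S₄ * c₂ ^ 2) (r₂ := S₁ * c₁ - S₄ * c₂) (r₃ := S₁ + S₄)
    fun a b hab => by linarith [hm a b hab]
  obtain ⟨ε, ⟨h1, h2, h3⟩, h0⟩ := (((e1.and (e2.and e3)).filter_mono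
    nhdsWithin_le_nhds).and (self_mem_nhdsWithin (s := Ioi (0 : ℝ)))).exists
  exact ⟨ε, h0, h1.le, fun a b => by linarith [h3 a b], h2.le⟩

/-- The closed loop with `q = 0` has no equilibrium of constant nonzero slope. -/
theorem add_ne_zero_of_boundary_dissipation
    (hl : S₂ * (1 - c₁ * g) ^ 2 < S₁ * (1 + c₁ * g) ^ 2)
    (hm : ∀ a b, (a, b) ≠ ((0 : ℝ), (0 : ℝ)) → S₁ * (b + c₁ * a) ^ 2 + S₄ * (b - c₂ * a) ^ 2 <
      S₂ * (b - c₁ * a) ^ 2 + S₃ * (b + c₂ * a) ^ 2)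
    (hr : S₃ * (1 - c₂ * h) ^ 2 < S₄ * (1 + c₂ * h) ^ 2) : g + h ≠ 0 := by
  intro h0
  obtain rfl : h = -g := by linarith
  -- If `h = -g`, slope `g` and velocity `1` on both strings satisfy all boundary conditions; for
  -- this state the joint balance contradicts the sum of the two end balances.
  have := hm g 1 (by simp)
  ring_nf at hl hr this
  linarith

end Margin

/-! ### From the two vertices to all parameters -/

section VertexConditions

/-- The inequalities of the theorem force `q = 0` (with `δ_max ≥ 1` the inequality `Ψ ≺ 0` is
infeasible), and they imply strict dissipation at the boundary for all parameters. -/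
theorem boundary_dissipation_of_negDef
    {cmin cmax gmin gmax zmax c₂ h q S₁ S₂ S₃ S₄ S₅ : ℝ}
    (hS₁ : 0 < S₁) (hS₂ : 0 < S₂)
    (hzmax' : reflection zmax = deltaMax cmin cmax gmin gmax)
    (hδ₁ : 1 ≤ deltaMax cmin cmax gmin gmax) (hδ₂ : deltaMax cmin cmax gmin gmax < ⊤)
    (hLMI : (IsNegDef (matPsi c₂ h q S₁ S₂ S₃ S₄ S₅ 0 cmin zmax) ∧
        IsNegDef (matPsi c₂ h q S₁ S₂ S₃ S₄ S₅ 0 cmax zmax)) ∨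
      (q = 0 ∧ IsNegDef (matPsiTilde c₂ h q S₁ S₂ S₃ S₄ S₅ cmin zmax) ∧
        IsNegDef (matPsiTilde c₂ h q S₁ S₂ S₃ S₄ S₅ cmax zmax)))
    {c₁ g : ℝ} (hc₁ : c₁ ∈ Icc cmin cmax) (hg : g ∈ Icc gmin gmax) :
    q = 0 ∧ S₂ * (1 - c₁ * g) ^ 2 < S₁ * (1 + c₁ * g) ^ 2 ∧
      (∀ a b, (a, b) ≠ ((0 : ℝ), (0 : ℝ)) → S₁ * (b + c₁ * a) ^ 2 + S₄ * (b - c₂ * a) ^ 2 <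
        S₂ * (b - c₁ * a) ^ 2 + S₃ * (b + c₂ * a) ^ 2) ∧
      S₃ * (1 - c₂ * h) ^ 2 < S₄ * (1 + c₂ * h) ^ 2 := by
  have hzm : 1 + zmax ≠ 0 := one_add_ne_zero_of_reflection_lt_top (hzmax' ▸ hδ₂)
  have hsq : (1 + zmax) ^ 2 ≤ (1 - zmax) ^ 2 := sq_le_of_one_le_reflection hzm (hzmax' ▸ hδ₁)
  have hpos : 0 < (1 + zmax) ^ 2 := by positivity
  rcases hLMI with ⟨hP, -⟩ | ⟨hq, hP, hP'⟩
  · exfalso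
    -- The three diagonal entries give `S₂ < S₁`, then `S₄ < S₃`, and then `(S₃ - S₄) * (c₂ * q) ^ 2
    -- < 0`.
    have h1 := hP.dotProduct_neg (x := ![1, 0, 0, 0, 0]) (by simp)
    have h3 := hP.dotProduct_neg (x := ![0, 0, 1, 0, 0]) (by simp)
    have h5 := hP.dotProduct_neg (x := ![0, 0, 0, 0, 1]) (by simp)
    rw [matPsi_form] at h1 h3 h5
    have h6 : S₂ < S₁ := by
      by_contra! hle
      nlinarith
    have h7 : S₄ < S₃ := by nlinarith
    nlinarith [sq_nonneg (c₂ * q)]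
  · have hleft : S₂ * (1 - zmax) ^ 2 < S₁ * (1 + zmax) ^ 2 := by
      have h1 := hP.dotProduct_neg (x := ![1, 0, 0, 0]) (by simp)
      rw [matPsiTilde_form] at h1
      linarith
    have hSS : S₂ < S₁ := by
      by_contra! hle
      nlinarith
    refine ⟨hq, ?_, fun a b hab => ?_, ?_⟩
    · have hle : reflection (c₁ * g) ≤ reflection zmax := by
        rw [hzmax']
        exact le_iSup₂ (f := fun z (_ : z ∈ uncertaintySet cmin cmax gmin gmax) => reflection z)
          (c₁ * g) ⟨c₁, hc₁, g, hg, rfl⟩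
      have hz : 1 + c₁ * g ≠ 0 :=
        one_add_ne_zero_of_reflection_lt_top (hle.trans_lt (hzmax' ▸ hδ₂))
      have h1 := sq_le_of_reflection_le hz hzm hle
      have h2 : 0 < (1 + c₁ * g) ^ 2 := by positivity
      refine lt_of_mul_lt_mul_right (a := (1 + zmax) ^ 2) ?_ hpos.le
      calc S₂ * (1 - c₁ * g) ^ 2 * (1 + zmax) ^ 2
          = S₂ * ((1 - c₁ * g) ^ 2 * (1 + zmax) ^ 2) := by ring
        _ ≤ S₂ * ((1 - zmax) ^ 2 * (1 + c₁ * g) ^ 2) := by gcongr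
        _ = S₂ * (1 - zmax) ^ 2 * (1 + c₁ * g) ^ 2 := by ring
        _ < S₁ * (1 + zmax) ^ 2 * (1 + c₁ * g) ^ 2 := by gcongr
        _ = _ := by ring
    · have hne : ![0, a, b, 0] ≠ 0 := by
        intro h0
        refine hab (Prod.ext ?_ ?_)
        · simpa using congrFun h0 1
        · simpa using congrFun h0 2
      have h1 := hP.dotProduct_neg hne
      have h2 := hP'.dotProduct_neg hne
      rw [matPsiTilde_form] at h1 h2
      -- The joint balance as a polynomial in `c₁`, convex because `S₂ < S₁`; `zmax` does not occur
      -- in it.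
      have h3 := quadratic_neg_of_endpoints (A := (S₁ - S₂) * a ^ 2)
        (B := 2 * (S₁ + S₂) * a * b)
        (C := (S₁ - S₂) * b ^ 2 + S₄ * (b - c₂ * a) ^ 2 - S₃ * (b + c₂ * a) ^ 2)
        (mul_nonneg (by linarith) (sq_nonneg a)) hc₁ (by linarith) (by linarith)
      linarith
    · have h1 := hP.dotProduct_neg (x := ![0, 0, 0, 1]) (by simp)
      rw [matPsiTilde_form] at h1
      linarith

end VertexConditions

/-! ### Bounded operators on `H¹` and `L²`, and integration by parts -/

section SobolevMaps

/-- Evaluation at a point as a bounded functional on `H¹`. -/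
def H1.valueL (x : unitInterval) : H1 →L[ℝ] ℝ :=
  (ContinuousMap.evalCLM ℝ x ∘L ContinuousLinearMap.fst ℝ C(unitInterval, ℝ) L2) ∘L
    sobolevH1.subtypeL

@[simp] theorem H1.valueL_apply (x : unitInterval) (f : H1) : H1.valueL x f = f.value x := rfl

/-- Differentiation as a bounded operator `H¹ → L²`. -/
def H1.dxL : H1 →L[ℝ] L2 :=
  ContinuousLinearMap.snd ℝ C(unitInterval, ℝ) L2 ∘L sobolevH1.subtypeL

/-- The constant functions in `H¹`. -/
def H1.const : ℝ →L[ℝ] H1 :=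
  ((((ContinuousLinearMap.id ℝ ℝ).smulRight (1 : C(unitInterval, ℝ))).prod 0).codRestrict sobolevH1
    (fun c x => by
      have h := (sobolevH1.zero_mem : (0 : C(unitInterval, ℝ) × L2) ∈ sobolevH1) x
      have h' : ∫ s in (0 : ℝ)..x, ((0 : L2) : ℝ → ℝ) s = 0 := by simpa using h.symm
      change c * 1 = c * 1 + ∫ s in (0 : ℝ)..x, ((0 : L2) : ℝ → ℝ) s
      rw [h', add_zero]))

@[simp] theorem H1.value_const (c : ℝ) (x : unitInterval) : (H1.const c).value x = c :=
  mul_one c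

@[simp] theorem H1.dx_const (c : ℝ) : (H1.const c).dx = 0 := rfl

theorem H1.value_eq (f : H1) (x : unitInterval) :
    f.value x = f.value 0 + ∫ s in (0 : ℝ)..x, f.dx s := f.2 x

theorem H1.continuous_value (f : H1) : Continuous f.value := f.1.1.continuous

theorem H1.ext_value_dx {f g : H1} (h0 : f.value 0 = g.value 0) (h : f.dx = g.dx) : f = g := by
  refine Subtype.ext (Prod.ext (ContinuousMap.ext fun x => ?_) h)
  change f.value x = g.value x
  rw [f.value_eq, g.value_eq, h0, h]

theorem memLp_of_continuous_unit {f : unitInterval → ℝ} (hf : Continuous f) :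
    MemLp (IccExtend (zero_le_one' ℝ) f) 2 unitMeasure := by
  have h1 : Continuous (IccExtend (zero_le_one' ℝ) f) := hf.Icc_extend'
  obtain ⟨C, hC⟩ := (isCompact_range hf).isBounded.exists_norm_le
  exact MemLp.of_bound h1.aestronglyMeasurable C
    (Eventually.of_forall fun x => hC _ ⟨projIcc 0 1 zero_le_one x, rfl⟩)

/-- The inclusion `H¹ → L²`. -/
def H1.toL2 : H1 →L[ℝ] L2 :=
  LinearMap.mkContinuous
    { toFun := fun f => (memLp_of_continuous_unit f.continuous_value).toLp _
      map_add' := fun _ _ => rfl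
      map_smul' := fun _ _ => rfl } 1 (by
    intro f
    rw [one_mul]
    change ‖(memLp_of_continuous_unit f.continuous_value).toLp _‖ ≤ ‖f‖
    have h1 : ∀ᵐ x ∂unitMeasure,
        ‖(memLp_of_continuous_unit f.continuous_value).toLp _ x‖ ≤ ‖f‖ := by
      filter_upwards [(memLp_of_continuous_unit f.continuous_value).coeFn_toLp] with x hx
      rw [hx]
      exact (f.1.1.norm_coe_le_norm _).trans (norm_fst_le f.1)
    have h2 := Lp.norm_le_of_ae_bound (norm_nonneg f) h1
    simpa [measureUnivNNReal] using h2)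

theorem H1.coeFn_toL2 (f : H1) :
    (H1.toL2 f : ℝ → ℝ) =ᵐ[unitMeasure] IccExtend (zero_le_one' ℝ) f.value :=
  (memLp_of_continuous_unit f.continuous_value).coeFn_toLp

theorem H1.represents_iff {f : H1} {w : L2} : f.Represents w ↔ H1.toL2 f = w := by
  constructor
  · intro h
    exact Lp.ext (f.coeFn_toL2.trans (EventuallyEq.symm h))
  · rintro rfl
    exact f.coeFn_toL2

theorem abs_integral_le_norm (w : L2) (x : unitInterval) :
    |∫ s in (0 : ℝ)..x, w s| ≤ ‖w‖ := by
  have hfin : unitMeasure (Ioc (0 : ℝ) x) ≠ ∞ := measure_ne_top _ _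
  have h1 : ∫ s in (0 : ℝ)..x, w s =
      inner ℝ (indicatorConstLp 2 measurableSet_Ioc hfin (1 : ℝ)) w := by
    rw [L2.inner_indicatorConstLp_one measurableSet_Ioc hfin w,
      intervalIntegral.integral_of_le x.2.1, Measure.restrict_restrict measurableSet_Ioc,
      inter_eq_self_of_subset_left (Ioc_subset_unit x)]
  rw [h1]
  refine (abs_real_inner_le_norm _ _).trans (mul_le_of_le_one_left (norm_nonneg _) ?_)
  rw [norm_indicatorConstLp (by norm_num) (by norm_num), norm_one, one_mul]
  refine Real.rpow_le_one measureReal_nonneg ?_ (by norm_num)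
  refine (measureReal_mono (subset_univ _)).trans ?_
  simp [measureReal_def]

theorem continuous_primitive (w : L2) :
    Continuous fun x : unitInterval => ∫ s in (0 : ℝ)..x, w s := by
  have h : IntegrableOn (w : ℝ → ℝ) (Icc 0 1) volume :=
    (Lp.memLp w).integrable (by norm_num)
  have h1 := intervalIntegral.continuousOn_primitive_interval (μ := volume) (a := 0) (b := 1)
    (f := w) (by rwa [uIcc_of_le zero_le_one])
  rw [uIcc_of_le zero_le_one] at h1
  exact h1.comp_continuous continuous_subtype_val fun x => x.2

theorem intervalIntegral_L2_add (v w : L2) (x : unitInterval) :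
    ∫ s in (0 : ℝ)..x, (v + w : L2) s = (∫ s in (0 : ℝ)..x, v s) + ∫ s in (0 : ℝ)..x, w s := by
  rw [← intervalIntegral.integral_add (L2.intervalIntegrable _ _) (L2.intervalIntegrable _ _),
    intervalIntegral.integral_of_le x.2.1, intervalIntegral.integral_of_le x.2.1]
  exact integral_congr_ae (EventuallyEq.filter_mono (Lp.coeFn_add v w)
    (ae_mono (Measure.restrict_mono (Ioc_subset_unit x) le_rfl)))

theorem intervalIntegral_L2_smul (c : ℝ) (w : L2) (x : unitInterval) :
    ∫ s in (0 : ℝ)..x, (c • w : L2) s = c * ∫ s in (0 : ℝ)..x, w s := by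
  rw [← intervalIntegral.integral_const_mul,
    intervalIntegral.integral_of_le x.2.1, intervalIntegral.integral_of_le x.2.1]
  exact integral_congr_ae (EventuallyEq.filter_mono (Lp.coeFn_smul c w)
    (ae_mono (Measure.restrict_mono (Ioc_subset_unit x) le_rfl)))

/-- The primitive vanishing at `0`, as a bounded operator `L² → H¹`. -/
def H1.primitive : L2 →L[ℝ] H1 :=
  LinearMap.mkContinuous
    { toFun := fun w => (⟨(⟨fun x => ∫ s in (0 : ℝ)..x, w s, continuous_primitive w⟩, w),
        fun x => by simp⟩ : sobolevH1)
      map_add' := fun v w =>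
        Subtype.ext (Prod.ext (ContinuousMap.ext fun x => intervalIntegral_L2_add v w x) rfl)
      map_smul' := fun c w =>
        Subtype.ext (Prod.ext (ContinuousMap.ext fun x => intervalIntegral_L2_smul c w x) rfl) } 1
    (by
      intro w
      rw [one_mul]
      refine max_le ?_ le_rfl
      exact (ContinuousMap.norm_le _ (norm_nonneg w)).2 fun x => abs_integral_le_norm w x)

@[simp] theorem H1.value_primitive_zero (w : L2) : (H1.primitive w).value 0 = 0 := by
  change ∫ s in (0 : ℝ)..((0 : unitInterval) : ℝ), w s = 0
  simp

@[simp] theorem H1.dx_primitive (w : L2) : (H1.primitive w).dx = w := rfl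

@[simp] theorem H1.value_add (f g : H1) (x : unitInterval) :
    (f + g).value x = f.value x + g.value x := rfl

@[simp] theorem H1.value_smul (c : ℝ) (f : H1) (x : unitInterval) :
    (c • f).value x = c * f.value x := rfl

@[simp] theorem H1.dx_add (f g : H1) : (f + g).dx = f.dx + g.dx := rfl

@[simp] theorem H1.dx_smul (c : ℝ) (f : H1) : (c • f).dx = c • f.dx := rfl

/-- A continuous function vanishing almost everywhere vanishes on `[0,1]`. The derivative is
separate data in `H1`; it vanishes by Lebesgue differentiation of its constant primitive. -/
theorem H1.toL2_injective {f : H1} (hf : H1.toL2 f = 0) : f = 0 := by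
  have h1 : IccExtend (zero_le_one' ℝ) f.value =ᵐ[volume.restrict (Icc 0 1)] fun _ => 0 := by
    refine f.coeFn_toL2.symm.trans ?_
    rw [hf]
    exact Lp.coeFn_zero ..
  have h2 := Measure.eqOn_Icc_of_ae_eq (μ := volume) zero_ne_one h1
    (f.continuous_value.Icc_extend').continuousOn continuousOn_const
  have h3 : ∀ x, f.value x = 0 := fun x => by
    have := h2 x.2
    rwa [IccExtend_val] at this
  have h4 : f.dx = 0 := by
    have hint : IntervalIntegrable (f.dx : ℝ → ℝ) volume 0 1 := L2.intervalIntegrable f.dx 1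
    refine Lp.ext (EventuallyEq.trans ?_ (Lp.coeFn_zero ..).symm)
    change _ =ᵐ[volume.restrict (Icc 0 1)] _
    rw [← Measure.restrict_congr_set (Ioo_ae_eq_Icc (μ := volume) (a := (0 : ℝ)) (b := 1))]
    filter_upwards [ae_restrict_mem measurableSet_Ioo,
      ae_restrict_of_ae hint.ae_hasDerivAt_integral] with x hx hd
    have h5 := hd (by rw [uIcc_of_le zero_le_one]; exact Ioo_subset_Icc_self hx) 0 (by simp)
    have h6 : (fun y => ∫ t in (0 : ℝ)..y, f.dx t) =ᶠ[𝓝 x] fun _ => (0 : ℝ) := by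
      filter_upwards [Ioo_mem_nhds hx.1 hx.2] with y hy
      have := f.value_eq ⟨y, Ioo_subset_Icc_self hy⟩
      rw [h3, h3] at this
      linarith
    exact h5.unique ((hasDerivAt_const x (0 : ℝ)).congr_of_eventuallyEq h6)
  exact H1.ext_value_dx (h3 0) h4

/-- Multiplication by `x` on `L²`. -/
def mulX : L2 →L[ℝ] L2 :=
  (ContinuousLinearMap.mul ℝ ℝ).holderL unitMeasure ∞ 2 2
    ((memLp_top_of_bound (μ := unitMeasure) (f := fun x : ℝ => x)
      measurable_id.aestronglyMeasurable 1
      ((ae_restrict_mem measurableSet_Icc).mono fun x hx => by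
        rw [Real.norm_eq_abs, abs_le]; constructor <;> linarith [hx.1, hx.2])).toLp _)

theorem coeFn_mulX (w : L2) : (mulX w : ℝ → ℝ) =ᵐ[unitMeasure] fun x => x * w x := by
  have hm := memLp_top_of_bound (μ := unitMeasure) (f := fun x : ℝ => x)
      measurable_id.aestronglyMeasurable 1
      ((ae_restrict_mem measurableSet_Icc).mono fun x hx => by
        rw [Real.norm_eq_abs, abs_le]; constructor <;> linarith [hx.1, hx.2])
  have h := (ContinuousLinearMap.mul ℝ ℝ).coeFn_holder (r := 2) (hm.toLp _) w
  filter_upwards [h, hm.coeFn_toLp] with x hx hx'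
  refine hx.trans ?_
  rw [hx']
  rfl

theorem inner_mulX_comm (v w : L2) : inner ℝ (mulX v) w = inner ℝ (mulX w) v := by
  rw [L2.inner_def, L2.inner_def]
  refine integral_congr_ae ?_
  filter_upwards [coeFn_mulX v, coeFn_mulX w] with x hv hw
  simp only [hv, hw, RCLike.inner_apply, conj_trivial]
  ring

theorem inner_mulX_self_nonneg (w : L2) : 0 ≤ inner ℝ (mulX w) w := by
  rw [L2.inner_def]
  refine integral_nonneg_of_ae ?_
  filter_upwards [coeFn_mulX w, ae_restrict_mem measurableSet_Icc] with x hw hx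
  simp only [hw, RCLike.inner_apply, conj_trivial, Pi.zero_apply]
  nlinarith [hx.1, mul_self_nonneg (w x), mul_nonneg hx.1 (mul_self_nonneg (w x))]

theorem inner_mulX_self_le (w : L2) : inner ℝ (mulX w) w ≤ ‖w‖ ^ 2 := by
  rw [← real_inner_self_eq_norm_sq, L2.inner_def, L2.inner_def]
  refine integral_mono_ae (L2.integrable_inner _ _) (L2.integrable_inner _ _) ?_
  filter_upwards [coeFn_mulX w, ae_restrict_mem measurableSet_Icc] with x hw hx
  simp only [hw, RCLike.inner_apply, conj_trivial]
  nlinarith [hx.2, mul_self_nonneg (w x)]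

/-- The integrand is almost everywhere the derivative of `(c + d x) F²`, where `F` is the absolutely
continuous representative. -/
theorem H1.integral_affine_mul_deriv (f : H1) (c d : ℝ) :
    ∫ x in (0 : ℝ)..1, (d * (f.value 0 + ∫ s in (0 : ℝ)..x, f.dx s) ^ 2 +
        2 * ((c + d * x) * (f.value 0 + ∫ s in (0 : ℝ)..x, f.dx s) * f.dx x)) =
      (c + d) * f.value 1 ^ 2 - c * f.value 0 ^ 2 := by
  set F : ℝ → ℝ := fun x => f.value 0 + ∫ s in (0 : ℝ)..x, f.dx s
  have hint : IntervalIntegrable (f.dx : ℝ → ℝ) volume 0 1 := L2.intervalIntegrable f.dx 1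
  have hF : AbsolutelyContinuousOnInterval F 0 1 := by
    refine AbsolutelyContinuousOnInterval.add ?_
      (hint.absolutelyContinuousOnInterval_intervalIntegral (by simp))
    exact (LipschitzWith.const (f.value 0)).lipschitzOnWith.absolutelyContinuousOnInterval
  have hφ : AbsolutelyContinuousOnInterval (fun x : ℝ => c + d * x) 0 1 :=
    ContDiffOn.absolutelyContinuousOnInterval (by fun_prop)
  have hF' : ∀ᵐ x, x ∈ uIcc (0 : ℝ) 1 → HasDerivAt F (f.dx x) x := by
    filter_upwards [hint.ae_hasDerivAt_integral] with x hx hx1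
    exact (hx hx1 0 (by simp)).const_add _
  have key := AbsolutelyContinuousOnInterval.integral_deriv_mul_eq_sub (hφ.fun_mul hF) hF
  have hF0 : F 0 = f.value 0 := by simp [F]
  have hF1 : F 1 = f.value 1 := (f.value_eq 1).symm
  rw [hF0, hF1] at key
  have h2 : (c + d) * f.value 1 ^ 2 - c * f.value 0 ^ 2 =
      (c + d * 1) * f.value 1 * f.value 1 - (c + d * 0) * f.value 0 * f.value 0 := by ring
  rw [h2, ← key]
  refine intervalIntegral.integral_congr_ae ?_
  filter_upwards [hF'] with x hx hx1
  have h3 := hx (uIoc_subset_uIcc hx1)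
  have h4 : HasDerivAt (fun x : ℝ => c + d * x) d x := by
    simpa using ((hasDerivAt_id x).const_mul d).const_add c
  have h5 : HasDerivAt (fun x : ℝ => (c + d * x) * F x) _ x := h4.mul h3
  rw [h5.deriv, h3.deriv]
  simp only [F]
  ring

theorem H1.coeFn_toL2_eq_primitive (f : H1) :
    (H1.toL2 f : ℝ → ℝ) =ᵐ[unitMeasure] fun x => f.value 0 + ∫ s in (0 : ℝ)..x, f.dx s := by
  filter_upwards [f.coeFn_toL2, ae_restrict_mem measurableSet_Icc] with x hx hx1
  rw [hx, IccExtend_of_mem _ _ hx1]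
  exact f.value_eq ⟨x, hx1⟩

/-- Integration by parts against the affine weight `c + d x`. -/
theorem H1.inner_affine_toL2_dx (f : H1) (c d : ℝ) :
    2 * (c * inner ℝ (H1.toL2 f) f.dx + d * inner ℝ (mulX (H1.toL2 f)) f.dx) =
      (c + d) * f.value 1 ^ 2 - c * f.value 0 ^ 2 - d * ‖H1.toL2 f‖ ^ 2 := by
  rw [← f.integral_affine_mul_deriv c d, ← real_inner_self_eq_norm_sq, L2.inner_def, L2.inner_def,
    L2.inner_def, eq_sub_iff_add_eq, ← integral_const_mul, ← integral_const_mul,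
    ← integral_const_mul,
    ← integral_add ((L2.integrable_inner _ _).const_mul _) ((L2.integrable_inner _ _).const_mul _),
    ← integral_const_mul, ← integral_add ((((L2.integrable_inner _ _).const_mul _).add
      ((L2.integrable_inner _ _).const_mul _)).const_mul _)
      ((L2.integrable_inner _ _).const_mul _),
    intervalIntegral.integral_of_le zero_le_one, ← integral_Icc_eq_integral_Ioc]
  refine integral_congr_ae ?_
  filter_upwards [f.coeFn_toL2_eq_primitive, coeFn_mulX (H1.toL2 f)] with x hx hx'
  simp only [hx', hx, RCLike.inner_apply, conj_trivial]
  ring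

end SobolevMaps

/-! ### The Hilbert space of energy vectors -/

section EnergyVectors

/-- Quadruples `(u_x, u_t, v_x, v_t)` of `L²` functions. -/
abbrev EnergyVec : Type := PiLp 2 fun _ : Fin 4 => L2

/-- The `i`-th component of an energy vector. -/
abbrev EnergyVec.coord (i : Fin 4) : EnergyVec →L[ℝ] L2 := PiLp.proj 2 (fun _ : Fin 4 => L2) i

/-- The energy vector with given components, depending linearly on a parameter. -/
def EnergyVec.ofCoords {F : Type*} [NormedAddCommGroup F] [NormedSpace ℝ F]
    (w₀ w₁ w₂ w₃ : F →L[ℝ] L2) : F →L[ℝ] EnergyVec :=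
  ((PiLp.continuousLinearEquiv 2 ℝ fun _ : Fin 4 => L2).symm :
    (Fin 4 → L2) →L[ℝ] EnergyVec) ∘L ContinuousLinearMap.pi ![w₀, w₁, w₂, w₃]

theorem EnergyVec.ext_coords {x y : EnergyVec} (h0 : x 0 = y 0) (h1 : x 1 = y 1) (h2 : x 2 = y 2)
    (h3 : x 3 = y 3) : x = y := by
  ext i : 1
  fin_cases i
  exacts [h0, h1, h2, h3]

end EnergyVectors

/-! ### Explicit solution of the stationary problem -/

section StationarySolution

/-- `(a, p, b, r)` satisfies the first order form of `A (u, p, v, r) = Z` with `u_x = a`,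
`v_x = b` and `q = 0`, where `f = (Z.u_x, Z.u_t, Z.v_x, Z.v_t)`. -/
structure IsStationary (c₁ g c₂ h : ℝ) (f : EnergyVec) (a p b r : H1) : Prop where
  dx_p : p.dx = f 0
  dx_a : c₁ ^ 2 • a.dx = f 1
  dx_r : r.dx = f 2
  dx_b : c₂ ^ 2 • b.dx = f 3
  left : a.value 0 = g * p.value 0
  middle_vel : r.value 0 = p.value 1
  middle_slope : b.value 0 = a.value 1
  right : b.value 1 = -h * r.value 1

variable (c₁ g c₂ h : ℝ)

/-- The boundary velocity `p(0)` of the stationary problem. -/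
def statVel : EnergyVec →L[ℝ] ℝ :=
  -(g + h)⁻¹ • (h • (H1.valueL 1 ∘L H1.primitive ∘L EnergyVec.coord 0)
    + h • (H1.valueL 1 ∘L H1.primitive ∘L EnergyVec.coord 2)
    + (c₁ ^ 2)⁻¹ • (H1.valueL 1 ∘L H1.primitive ∘L EnergyVec.coord 1)
    + (c₂ ^ 2)⁻¹ • (H1.valueL 1 ∘L H1.primitive ∘L EnergyVec.coord 3))

/-- The component `p` of the solution of the stationary problem. -/
def statP : EnergyVec →L[ℝ] H1 :=
  H1.const ∘L statVel c₁ g c₂ h + H1.primitive ∘L EnergyVec.coord 0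

/-- The component `a = u_x` of the solution of the stationary problem. -/
def statA : EnergyVec →L[ℝ] H1 :=
  g • (H1.const ∘L statVel c₁ g c₂ h) + (c₁ ^ 2)⁻¹ • (H1.primitive ∘L EnergyVec.coord 1)

/-- The component `r` of the solution of the stationary problem. -/
def statR : EnergyVec →L[ℝ] H1 :=
  H1.const ∘L H1.valueL 1 ∘L statP c₁ g c₂ h + H1.primitive ∘L EnergyVec.coord 2

/-- The component `b = v_x` of the solution of the stationary problem. -/
def statB : EnergyVec →L[ℝ] H1 :=
  H1.const ∘L H1.valueL 1 ∘L statA c₁ g c₂ h +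
    (c₂ ^ 2)⁻¹ • (H1.primitive ∘L EnergyVec.coord 3)

/-- The solution operator `(Z.u_x, Z.u_t, Z.v_x, Z.v_t) ↦ (u_x, p, v_x, r)` of the stationary
problem `A (u, p, v, r) = Z`. -/
def statOp : EnergyVec →L[ℝ] EnergyVec :=
  EnergyVec.ofCoords (H1.toL2 ∘L statA c₁ g c₂ h) (H1.toL2 ∘L statP c₁ g c₂ h)
    (H1.toL2 ∘L statB c₁ g c₂ h) (H1.toL2 ∘L statR c₁ g c₂ h)

variable {c₁ g c₂ h}

theorem isStationary_stat (hc₁ : c₁ ≠ 0) (hc₂ : c₂ ≠ 0) (hgh : g + h ≠ 0) (f : EnergyVec) :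
    IsStationary c₁ g c₂ h f (statA c₁ g c₂ h f) (statP c₁ g c₂ h f) (statB c₁ g c₂ h f)
      (statR c₁ g c₂ h f) where
  dx_p := by simp [statP]
  dx_a := by simp [statA, hc₁]
  dx_r := by simp [statR]
  dx_b := by simp [statB, hc₂]
  left := by simp [statA, statP]
  middle_vel := by simp [statR]
  middle_slope := by simp [statB]
  -- Inserting the primitives turns this condition into a linear equation for `p(0)` with
  -- coefficient `g + h`, which `statVel` solves.
  right := by
    simp only [statB, statR, statA, statP, statVel, add_apply, smul_apply,
      ContinuousLinearMap.comp_apply, H1.value_add, H1.value_smul, H1.value_const,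
      H1.valueL_apply, smul_eq_mul]
    field_simp
    ring

/-- The difference of two solutions has constant components, and the boundary conditions reduce to
`g + h` times its `p`-component being zero. -/
theorem IsStationary.eq_stat (hc₁ : c₁ ≠ 0) (hc₂ : c₂ ≠ 0) (hgh : g + h ≠ 0) {f : EnergyVec}
    {a p b r : H1} (hs : IsStationary c₁ g c₂ h f a p b r) :
    a = statA c₁ g c₂ h f ∧ p = statP c₁ g c₂ h f ∧ b = statB c₁ g c₂ h f ∧
      r = statR c₁ g c₂ h f := by
  have ht := isStationary_stat hc₁ hc₂ hgh f
  set a' := statA c₁ g c₂ h f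
  set p' := statP c₁ g c₂ h f
  set b' := statB c₁ g c₂ h f
  set r' := statR c₁ g c₂ h f
  have hp : p.dx = p'.dx := hs.dx_p.trans ht.dx_p.symm
  have hr : r.dx = r'.dx := hs.dx_r.trans ht.dx_r.symm
  have ha : a.dx = a'.dx :=
    smul_right_injective L2 (pow_ne_zero 2 hc₁) (hs.dx_a.trans ht.dx_a.symm)
  have hb : b.dx = b'.dx :=
    smul_right_injective L2 (pow_ne_zero 2 hc₂) (hs.dx_b.trans ht.dx_b.symm)
  have key : ∀ {f f' : H1}, f.dx = f'.dx → f.value 1 - f'.value 1 = f.value 0 - f'.value 0 := by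
    intro f f' hf
    rw [f.value_eq 1, f'.value_eq 1, hf]
    ring
  have kp := key hp
  have kr := key hr
  have ka := key ha
  have kb := key hb
  have h1 := hs.left
  have h2 := hs.middle_vel
  have h3 := hs.middle_slope
  have h4 := hs.right
  have h1' := ht.left
  have h2' := ht.middle_vel
  have h3' := ht.middle_slope
  have h4' := ht.right
  have h5 : (g + h) * (p.value 0 - p'.value 0) = 0 := by
    have e1 : r.value 1 - r'.value 1 = p.value 0 - p'.value 0 := by linarith
    have e2 : b.value 1 - b'.value 1 = -h * (r.value 1 - r'.value 1) := by rw [h4, h4']; ring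
    have e3 : a.value 0 - a'.value 0 = g * (p.value 0 - p'.value 0) := by rw [h1, h1']; ring
    rw [e1] at e2
    linarith
  have h6 : p.value 0 = p'.value 0 :=
    sub_eq_zero.1 ((mul_eq_zero.1 h5).resolve_left hgh)
  have h7 : a.value 0 = a'.value 0 := by rw [h1, h1', h6]
  exact ⟨H1.ext_value_dx h7 ha, H1.ext_value_dx h6 hp, H1.ext_value_dx (by linarith) hb,
    H1.ext_value_dx (by linarith) hr⟩

theorem statOp_injective (hc₁ : c₁ ≠ 0) (hc₂ : c₂ ≠ 0) (hgh : g + h ≠ 0) {f : EnergyVec}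
    (hf : statOp c₁ g c₂ h f = 0) : f = 0 := by
  have ht := isStationary_stat hc₁ hc₂ hgh f
  have h0 := congrArg (fun x : EnergyVec => x 0) hf
  have h1 := congrArg (fun x : EnergyVec => x 1) hf
  have h2 := congrArg (fun x : EnergyVec => x 2) hf
  have h3 := congrArg (fun x : EnergyVec => x 3) hf
  have ha := H1.toL2_injective (f := statA c₁ g c₂ h f) h0
  have hp := H1.toL2_injective (f := statP c₁ g c₂ h f) h1
  have hb := H1.toL2_injective (f := statB c₁ g c₂ h f) h2
  have hr := H1.toL2_injective (f := statR c₁ g c₂ h f) h3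
  have d0 : (0 : H1).dx = 0 := rfl
  refine EnergyVec.ext_coords ?_ ?_ ?_ ?_
  · rw [← ht.dx_p, hp]; rfl
  · rw [← ht.dx_a, ha, d0, smul_zero]; rfl
  · rw [← ht.dx_r, hr]; rfl
  · rw [← ht.dx_b, hb, d0, smul_zero]; rfl

end StationarySolution

/-! ### The Lyapunov form and its dissipation -/

section LyapunovForm

/-- The form `(x, y) ↦ ⟨(c + d x) ξ x, ξ y⟩`. -/
def weightedForm (ξ : EnergyVec →L[ℝ] L2) (c d : ℝ) : EnergyVec →L[ℝ] EnergyVec →L[ℝ] ℝ :=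
  ContinuousLinearMap.bilinearComp (innerSL ℝ : L2 →L[ℝ] L2 →L[ℝ] ℝ) (c • ξ + d • (mulX ∘L ξ)) ξ

theorem weightedForm_apply (ξ : EnergyVec →L[ℝ] L2) (c d : ℝ) (x y : EnergyVec) :
    weightedForm ξ c d x y = c * inner ℝ (ξ x) (ξ y) + d * inner ℝ (mulX (ξ x)) (ξ y) := by
  change inner ℝ (c • ξ x + d • mulX (ξ x)) (ξ y) = _
  rw [inner_add_left, real_inner_smul_left, real_inner_smul_left]

theorem weightedForm_symm (ξ : EnergyVec →L[ℝ] L2) (c d : ℝ) (x y : EnergyVec) :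
    weightedForm ξ c d x y = weightedForm ξ c d y x := by
  rw [weightedForm_apply, weightedForm_apply, real_inner_comm, inner_mulX_comm]

/-- Both weights `1 + ε x` and `1 + ε - ε x` take values in `[1, 1 + ε]` on the unit interval. -/
theorem weightedForm_bounds (ξ : EnergyVec →L[ℝ] L2) {ε : ℝ} (hε : 0 ≤ ε) (x : EnergyVec) :
    (‖ξ x‖ ^ 2 ≤ weightedForm ξ 1 ε x x ∧ weightedForm ξ 1 ε x x ≤ (1 + ε) * ‖ξ x‖ ^ 2) ∧
    ‖ξ x‖ ^ 2 ≤ weightedForm ξ (1 + ε) (-ε) x x ∧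
      weightedForm ξ (1 + ε) (-ε) x x ≤ (1 + ε) * ‖ξ x‖ ^ 2 := by
  rw [weightedForm_apply, weightedForm_apply, real_inner_self_eq_norm_sq]
  have h1 := mul_le_mul_of_nonneg_left (inner_mulX_self_le (ξ x)) hε
  have h2 := mul_nonneg hε (inner_mulX_self_nonneg (ξ x))
  refine ⟨⟨?_, ?_⟩, ?_, ?_⟩ <;> linarith

variable (c₁ c₂ S₁ S₂ S₃ S₄ ε : ℝ)

/-- The Riemann coordinate `y + c x` of a pair of components `(x, y)`. -/
def riemann (c : ℝ) (i j : Fin 4) : EnergyVec →L[ℝ] L2 :=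
  EnergyVec.coord j + c • EnergyVec.coord i

/-- The Lyapunov form, a sum of weighted `L²` products of the Riemann coordinates
`u_t ± c₁ u_x`, `v_t ± c₂ v_x`; the weights increase in the direction opposite to transport. -/
def lyapunovForm : EnergyVec →L[ℝ] EnergyVec →L[ℝ] ℝ :=
  (S₁ / c₁) • weightedForm (riemann c₁ 0 1) 1 ε
    + (S₂ / c₁) • weightedForm (riemann (-c₁) 0 1) (1 + ε) (-ε)
    + (S₃ / c₂) • weightedForm (riemann c₂ 2 3) 1 ε
    + (S₄ / c₂) • weightedForm (riemann (-c₂) 2 3) (1 + ε) (-ε)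

theorem lyapunovForm_apply (x y : EnergyVec) :
    lyapunovForm c₁ c₂ S₁ S₂ S₃ S₄ ε x y =
      (S₁ / c₁) * weightedForm (riemann c₁ 0 1) 1 ε x y
      + (S₂ / c₁) * weightedForm (riemann (-c₁) 0 1) (1 + ε) (-ε) x y
      + (S₃ / c₂) * weightedForm (riemann c₂ 2 3) 1 ε x y
      + (S₄ / c₂) * weightedForm (riemann (-c₂) 2 3) (1 + ε) (-ε) x y := rfl

theorem lyapunovForm_symm (x y : EnergyVec) :
    lyapunovForm c₁ c₂ S₁ S₂ S₃ S₄ ε x y = lyapunovForm c₁ c₂ S₁ S₂ S₃ S₄ ε y x := by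
  simp only [lyapunovForm_apply]
  rw [weightedForm_symm _ _ _ x y, weightedForm_symm _ _ _ x y, weightedForm_symm _ _ _ x y,
    weightedForm_symm _ _ _ x y]

variable {c₁ c₂ S₁ S₂ S₃ S₄ ε}

theorem norm_riemann_sq_add (c : ℝ) (i j : Fin 4) (x : EnergyVec) :
    ‖riemann c i j x‖ ^ 2 + ‖riemann (-c) i j x‖ ^ 2 = 2 * (c ^ 2 * ‖x i‖ ^ 2 + ‖x j‖ ^ 2) := by
  have h := parallelogram_law_with_norm ℝ (x j) (c • x i)
  have h1 : riemann c i j x = x j + c • x i := rfl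
  have h2 : riemann (-c) i j x = x j - c • x i := by
    change x j + (-c) • x i = _
    rw [neg_smul, sub_eq_add_neg]
  rw [h1, h2]
  rw [norm_smul, Real.norm_eq_abs] at h
  have := sq_abs c
  nlinarith

/-- Riemann coordinates diagonalise the stationary system: that of `x` is `p + c a`, and that of `f`
is `c` times its derivative. Integration by parts leaves boundary terms and a bulk term; `c` may be
negative, which covers both directions of transport. -/
theorem riemann_form_stat {c : ℝ} (hc : c ≠ 0) {a p : H1} {x f : EnergyVec} {i j : Fin 4}
    (hxi : x i = H1.toL2 a) (hxj : x j = H1.toL2 p) (hfi : p.dx = f i) (hfj : c ^ 2 • a.dx = f j)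
    (k d : ℝ) :
    2 * (c⁻¹ * weightedForm (riemann c i j) k d x f) =
      (k + d) * (p.value 1 + c * a.value 1) ^ 2 - k * (p.value 0 + c * a.value 0) ^ 2
        - d * ‖riemann c i j x‖ ^ 2 := by
  have h1 : riemann c i j x = H1.toL2 (p + c • a) := by
    change x j + c • x i = _
    rw [hxi, hxj, map_add, map_smul]
  have h2 : riemann c i j f = c • (p + c • a).dx := by
    change f j + c • f i = _
    rw [← hfi, ← hfj, H1.dx_add, H1.dx_smul, smul_add, smul_smul, sq, add_comm]
  have h3 := (p + c • a).inner_affine_toL2_dx k d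
  rw [weightedForm_apply, h1, h2, real_inner_smul_right, real_inner_smul_right]
  simp only [H1.value_add, H1.value_smul] at h3
  rw [← h3]
  field_simp

/-- Dissipation of the Lyapunov form along the closed loop. -/
theorem lyapunovForm_stat_le {g h : ℝ} (hc₁ : 0 < c₁) (hc₂ : 0 < c₂) (hS₁ : 0 < S₁) (hS₂ : 0 < S₂)
    (hS₃ : 0 < S₃) (hS₄ : 0 < S₄) (hε : 0 < ε) (hgh : g + h ≠ 0)
    (hM : BoundaryMargin c₁ g c₂ h S₁ S₂ S₃ S₄ ε) (f : EnergyVec) :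
    lyapunovForm c₁ c₂ S₁ S₂ S₃ S₄ ε (statOp c₁ g c₂ h f) f ≤
      -(ε * min c₁ c₂ / (2 * (1 + ε))) *
        lyapunovForm c₁ c₂ S₁ S₂ S₃ S₄ ε (statOp c₁ g c₂ h f) (statOp c₁ g c₂ h f) := by
  have ht := isStationary_stat hc₁.ne' hc₂.ne' hgh f
  set x := statOp c₁ g c₂ h f with hx
  set a := statA c₁ g c₂ h f
  set p := statP c₁ g c₂ h f
  set b := statB c₁ g c₂ h f
  set r := statR c₁ g c₂ h f
  have hx0 : x 0 = H1.toL2 a := rfl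
  have hx1 : x 1 = H1.toL2 p := rfl
  have hx2 : x 2 = H1.toL2 b := rfl
  have hx3 : x 3 = H1.toL2 r := rfl
  have e1 := riemann_form_stat hc₁.ne' hx0 hx1 ht.dx_p ht.dx_a 1 ε
  have e2 := riemann_form_stat (neg_ne_zero.2 hc₁.ne') hx0 hx1 ht.dx_p
    (by rw [neg_sq]; exact ht.dx_a) (1 + ε) (-ε)
  have e3 := riemann_form_stat hc₂.ne' hx2 hx3 ht.dx_r ht.dx_b 1 ε
  have e4 := riemann_form_stat (neg_ne_zero.2 hc₂.ne') hx2 hx3 ht.dx_r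
    (by rw [neg_sq]; exact ht.dx_b) (1 + ε) (-ε)
  -- In `e1` to `e4`, entering waves carry the weight `1 + ε` and leaving waves the weight `1`, so
  -- the margin makes the total boundary contribution nonpositive.
  have m1 := mul_le_mul_of_nonneg_right hM.left (sq_nonneg (p.value 0))
  have m2 := hM.middle (a.value 1) (p.value 1)
  have m3 := mul_le_mul_of_nonneg_right hM.right (sq_nonneg (r.value 1))
  rw [ht.left] at e1 e2
  rw [ht.middle_vel, ht.middle_slope, ht.right] at e3 e4
  obtain ⟨⟨-, u1⟩, -⟩ := weightedForm_bounds (riemann c₁ 0 1) hε.le x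
  obtain ⟨-, -, u2⟩ := weightedForm_bounds (riemann (-c₁) 0 1) hε.le x
  obtain ⟨⟨-, u3⟩, -⟩ := weightedForm_bounds (riemann c₂ 2 3) hε.le x
  obtain ⟨-, -, u4⟩ := weightedForm_bounds (riemann (-c₂) 2 3) hε.le x
  have hmin : 0 < min c₁ c₂ := lt_min hc₁ hc₂
  -- The bulk terms supply `ε / 2 * (S * n)` per coordinate. The decay rate is what remains after
  -- bounding the weight by `1 + ε` and the speed below by the minimum.
  have hrate : ∀ {S c n w : ℝ}, 0 < S → 0 < c → min c₁ c₂ ≤ c → 0 ≤ n → w ≤ (1 + ε) * n →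
      ε * min c₁ c₂ / (2 * (1 + ε)) * (S / c * w) ≤ ε / 2 * (S * n) := by
    intro S c n w hS hc hle hn hw
    calc ε * min c₁ c₂ / (2 * (1 + ε)) * (S / c * w)
        ≤ ε * min c₁ c₂ / (2 * (1 + ε)) * (S / c * ((1 + ε) * n)) := by gcongr
      _ ≤ ε * c / (2 * (1 + ε)) * (S / c * ((1 + ε) * n)) := by gcongr
      _ = _ := by field_simp
  have r1 := hrate hS₁ hc₁ (min_le_left _ _) (sq_nonneg _) u1
  have r2 := hrate hS₂ hc₁ (min_le_left _ _) (sq_nonneg _) u2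
  have r3 := hrate hS₃ hc₂ (min_le_right _ _) (sq_nonneg _) u3
  have r4 := hrate hS₄ hc₂ (min_le_right _ _) (sq_nonneg _) u4
  rw [lyapunovForm_apply, lyapunovForm_apply]
  rw [inv_neg] at e2 e4
  have f1 := congrArg (S₁ * ·) e1
  have f2 := congrArg (S₂ * ·) e2
  have f3 := congrArg (S₃ * ·) e3
  have f4 := congrArg (S₄ * ·) e4
  simp only [div_eq_mul_inv] at r1 r2 r3 r4 ⊢
  linarith

/-- The weights lie in `[1, 1 + ε]`, and by the parallelogram law the two Riemann coordinates of a
string carry twice its energy. -/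
theorem lyapunovForm_bounds (hc₁ : 0 < c₁) (hc₂ : 0 < c₂) (hS₁ : 0 < S₁) (hS₂ : 0 < S₂)
    (hS₃ : 0 < S₃) (hS₄ : 0 < S₄) (hε : 0 < ε) :
    ∃ m K : ℝ, 0 < m ∧ 0 < K ∧ ∀ x : EnergyVec,
      m * (c₁ ^ 2 * ‖x 0‖ ^ 2 + ‖x 1‖ ^ 2 + c₂ ^ 2 * ‖x 2‖ ^ 2 + ‖x 3‖ ^ 2) ≤
        lyapunovForm c₁ c₂ S₁ S₂ S₃ S₄ ε x x ∧
      lyapunovForm c₁ c₂ S₁ S₂ S₃ S₄ ε x x ≤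
        K * (c₁ ^ 2 * ‖x 0‖ ^ 2 + ‖x 1‖ ^ 2 + c₂ ^ 2 * ‖x 2‖ ^ 2 + ‖x 3‖ ^ 2) := by
  have k1 : 0 < S₁ / c₁ := by positivity
  have k2 : 0 < S₂ / c₁ := by positivity
  have k3 : 0 < S₃ / c₂ := by positivity
  have k4 : 0 < S₄ / c₂ := by positivity
  set m := min (min (S₁ / c₁) (S₂ / c₁)) (min (S₃ / c₂) (S₄ / c₂)) with hm
  set K := S₁ / c₁ + S₂ / c₁ + S₃ / c₂ + S₄ / c₂ with hK
  have hmpos : 0 < m := lt_min (lt_min k1 k2) (lt_min k3 k4)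
  refine ⟨2 * m, 2 * ((1 + ε) * K), by positivity, by positivity, fun x => ?_⟩
  obtain ⟨⟨l1, u1⟩, -⟩ := weightedForm_bounds (riemann c₁ 0 1) hε.le x
  obtain ⟨-, l2, u2⟩ := weightedForm_bounds (riemann (-c₁) 0 1) hε.le x
  obtain ⟨⟨l3, u3⟩, -⟩ := weightedForm_bounds (riemann c₂ 2 3) hε.le x
  obtain ⟨-, l4, u4⟩ := weightedForm_bounds (riemann (-c₂) 2 3) hε.le x
  have p1 := norm_riemann_sq_add c₁ 0 1 x
  have p2 := norm_riemann_sq_add c₂ 2 3 x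
  have lower : ∀ {s n w : ℝ}, m ≤ s → 0 ≤ n → n ≤ w → m * n ≤ s * w := fun hs hn hw => by
    gcongr
    exact hmpos.le.trans hs
  have upper : ∀ {s n w : ℝ}, 0 ≤ s → s ≤ K → 0 ≤ n → w ≤ (1 + ε) * n →
      s * w ≤ (1 + ε) * K * n := fun {s n w} h0 hs hn hw => by
    calc s * w ≤ s * ((1 + ε) * n) := by gcongr
      _ ≤ K * ((1 + ε) * n) := by gcongr
      _ = _ := by ring
  rw [lyapunovForm_apply]
  constructor
  · have a1 := lower (s := S₁ / c₁) (by simp [hm]) (sq_nonneg _) l1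
    have a2 := lower (s := S₂ / c₁) (by simp [hm]) (sq_nonneg _) l2
    have a3 := lower (s := S₃ / c₂) (by simp [hm]) (sq_nonneg _) l3
    have a4 := lower (s := S₄ / c₂) (by simp [hm]) (sq_nonneg _) l4
    have q1 := congrArg (m * ·) p1
    have q2 := congrArg (m * ·) p2
    simp only at q1 q2
    linarith
  · have a1 := upper (s := S₁ / c₁) k1.le (by linarith) (sq_nonneg _) u1
    have a2 := upper (s := S₂ / c₁) k2.le (by linarith) (sq_nonneg _) u2
    have a3 := upper (s := S₃ / c₂) k3.le (by linarith) (sq_nonneg _) u3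
    have a4 := upper (s := S₄ / c₂) k4.le (by linarith) (sq_nonneg _) u4
    have q1 := congrArg ((1 + ε) * K * ·) p1
    have q2 := congrArg ((1 + ε) * K * ·) p2
    simp only at q1 q2
    linarith

theorem isCoercive_lyapunovForm (hc₁ : 0 < c₁) (hc₂ : 0 < c₂) (hS₁ : 0 < S₁) (hS₂ : 0 < S₂)
    (hS₃ : 0 < S₃) (hS₄ : 0 < S₄) (hε : 0 < ε) :
    IsCoercive (lyapunovForm c₁ c₂ S₁ S₂ S₃ S₄ ε) := by
  obtain ⟨m, K, hm, -, hmK⟩ := lyapunovForm_bounds hc₁ hc₂ hS₁ hS₂ hS₃ hS₄ hε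
  set k := min 1 (min (c₁ ^ 2) (c₂ ^ 2)) with hk
  have hkpos : 0 < k := lt_min one_pos (lt_min (by positivity) (by positivity))
  refine ⟨m * k, by positivity, fun x => ?_⟩
  refine le_trans ?_ (hmK x).1
  have hk0 : k ≤ 1 := min_le_left _ _
  have hk1 : k ≤ c₁ ^ 2 := (min_le_right _ _).trans (min_le_left _ _)
  have hk2 : k ≤ c₂ ^ 2 := (min_le_right _ _).trans (min_le_right _ _)
  rw [mul_assoc, mul_assoc, ← sq, PiLp.norm_sq_eq_of_L2, Fin.sum_univ_four]
  gcongr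
  have b0 := mul_le_mul_of_nonneg_right hk1 (sq_nonneg ‖x 0‖)
  have b1 := mul_le_mul_of_nonneg_right hk0 (sq_nonneg ‖x 1‖)
  have b2 := mul_le_mul_of_nonneg_right hk2 (sq_nonneg ‖x 2‖)
  have b3 := mul_le_mul_of_nonneg_right hk0 (sq_nonneg ‖x 3‖)
  linarith

end LyapunovForm

/-! ### Transfer between energy vectors and states of the closed loop -/

section ClosedLoop

/-- The component `u` of a state as a bounded operator. -/
def State.uL : State →L[ℝ] H1 :=
  ContinuousLinearMap.fst ℝ H1 (L2 × H1 × L2) ∘L energySpace.subtypeL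

/-- The component `u_t` of a state as a bounded operator. -/
def State.utL : State →L[ℝ] L2 :=
  (ContinuousLinearMap.fst ℝ L2 (H1 × L2) ∘L ContinuousLinearMap.snd ℝ H1 (L2 × H1 × L2)) ∘L
    energySpace.subtypeL

/-- The component `v` of a state as a bounded operator. -/
def State.vL : State →L[ℝ] H1 :=
  (ContinuousLinearMap.fst ℝ H1 L2 ∘L ContinuousLinearMap.snd ℝ L2 (H1 × L2) ∘L
    ContinuousLinearMap.snd ℝ H1 (L2 × H1 × L2)) ∘L energySpace.subtypeL

/-- The component `v_t` of a state as a bounded operator. -/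
def State.vtL : State →L[ℝ] L2 :=
  (ContinuousLinearMap.snd ℝ H1 L2 ∘L ContinuousLinearMap.snd ℝ L2 (H1 × L2) ∘L
    ContinuousLinearMap.snd ℝ H1 (L2 × H1 × L2)) ∘L energySpace.subtypeL

/-- The energy vector `(u_x, u_t, v_x, v_t)` of a state. -/
def State.energyVec : State →L[ℝ] EnergyVec :=
  EnergyVec.ofCoords (H1.dxL ∘L State.uL) State.utL (H1.dxL ∘L State.vL) State.vtL

theorem State.ext_components {X Y : State} (hu : X.u = Y.u) (hut : X.ut = Y.ut) (hv : X.v = Y.v)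
    (hvt : X.vt = Y.vt) : X = Y :=
  Subtype.ext (Prod.ext hu (Prod.ext hut (Prod.ext hv hvt)))

theorem State.value_one_eq (X : State) : X.u.value 1 = X.v.value 0 := X.2

variable {c₁ g c₂ h : ℝ}

/-- For `q = 0`, the relation `A Y = Z` in terms of energy vectors. -/
theorem isImageUnderA_iff (hc₁ : c₁ ≠ 0) (hc₂ : c₂ ≠ 0) (hgh : g + h ≠ 0) (Y Z : State) :
    IsImageUnderA c₁ g c₂ h 0 Y Z ↔
      statOp c₁ g c₂ h Z.energyVec = Y.energyVec ∧ Z.u = statP c₁ g c₂ h Z.energyVec ∧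
        Z.v = statR c₁ g c₂ h Z.energyVec := by
  constructor
  · rintro ⟨hp, hr, a, b, ha, hb, hut, hvt, h0, hm, h1⟩
    rw [H1.represents_iff] at hp hr ha hb
    have hs : IsStationary c₁ g c₂ h Z.energyVec a Z.u b Z.v :=
      ⟨rfl, hut.symm, rfl, hvt.symm, h0, Z.value_one_eq.symm, hm, by simpa using h1⟩
    obtain ⟨ea, ep, eb, er⟩ := hs.eq_stat hc₁ hc₂ hgh
    refine ⟨EnergyVec.ext_coords ?_ ?_ ?_ ?_, ep, er⟩
    · change H1.toL2 (statA c₁ g c₂ h Z.energyVec) = Y.u.dx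
      rw [← ea, ha]
    · change H1.toL2 (statP c₁ g c₂ h Z.energyVec) = Y.ut
      rw [← ep, hp]
    · change H1.toL2 (statB c₁ g c₂ h Z.energyVec) = Y.v.dx
      rw [← eb, hb]
    · change H1.toL2 (statR c₁ g c₂ h Z.energyVec) = Y.vt
      rw [← er, hr]
  · rintro ⟨hT, hu, hv⟩
    have hs := isStationary_stat hc₁ hc₂ hgh Z.energyVec
    rw [← hu, ← hv] at hs
    simp only [IsImageUnderA, H1.represents_iff]
    refine ⟨?_, ?_, statA c₁ g c₂ h Z.energyVec, statB c₁ g c₂ h Z.energyVec, ?_, ?_, hs.dx_a.symm,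
      hs.dx_b.symm, hs.left, hs.middle_slope, by simpa using hs.right⟩
    · rw [hu]
      exact congrArg (fun x : EnergyVec => x 1) hT
    · rw [hv]
      exact congrArg (fun x : EnergyVec => x 3) hT
    · exact congrArg (fun x : EnergyVec => x 0) hT
    · exact congrArg (fun x : EnergyVec => x 2) hT

theorem IsSolution.isMildSolution (hc₁ : c₁ ≠ 0) (hc₂ : c₂ ≠ 0) (hgh : g + h ≠ 0) {X₀ : State}
    {X : ℝ≥0 → State} (hX : IsSolution c₁ g c₂ h 0 X₀ X) :
    IsMildSolution (statOp c₁ g c₂ h) fun t => (X t.toNNReal).energyVec := by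
  obtain ⟨h0, hc, hA⟩ := hX
  have hc' : Continuous fun t : ℝ => X t.toNNReal := hc.comp continuous_real_toNNReal
  refine ⟨State.energyVec.continuous.comp hc', fun t ht => ?_⟩
  have h1 := ((isImageUnderA_iff hc₁ hc₂ hgh _ _).1 (hA t.toNNReal)).1
  rw [Real.coe_toNNReal t ht, ← h0] at h1
  simp only [Real.toNNReal_zero]
  rw [← map_sub, h1]
  exact (State.energyVec.intervalIntegral_comp_comm (hc'.intervalIntegrable _ _)).symm

/-- Energy vectors forget additive constants in the positions. The relation `X t - X₀ = A ∫ X`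
restores them, since the displacements are the stationary solution for the increment of the energy
vector. -/
theorem IsSolution.eq_of_energyVec_eq (hc₁ : c₁ ≠ 0) (hc₂ : c₂ ≠ 0) (hgh : g + h ≠ 0) {X₀ : State}
    {X Y : ℝ≥0 → State} (hX : IsSolution c₁ g c₂ h 0 X₀ X) (hY : IsSolution c₁ g c₂ h 0 X₀ Y)
    (hXY : ∀ t, (X t).energyVec = (Y t).energyVec) : X = Y := by
  funext t
  obtain ⟨-, huX, hvX⟩ := (isImageUnderA_iff hc₁ hc₂ hgh _ _).1 (hX.2.2 t)
  obtain ⟨-, huY, hvY⟩ := (isImageUnderA_iff hc₁ hc₂ hgh _ _).1 (hY.2.2 t)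
  have he : (X t - X₀).energyVec = (Y t - X₀).energyVec := by
    rw [map_sub, map_sub, hXY]
  refine State.ext_components ?_ (congrArg (fun x : EnergyVec => x 1) (hXY t)) ?_
    (congrArg (fun x : EnergyVec => x 3) (hXY t))
  · have h1 : (X t - X₀).u = (Y t - X₀).u := by rw [huX, huY, he]
    exact sub_left_injective (b := X₀.u) h1
  · have h1 : (X t - X₀).v = (Y t - X₀).v := by rw [hvX, hvY, he]
    exact sub_left_injective (b := X₀.v) h1

/-- A mild solution for the energy vectors comes from a solution of the closed loop. -/
theorem exists_isSolution_of_isMildSolution (hc₁ : c₁ ≠ 0) (hc₂ : c₂ ≠ 0) (hgh : g + h ≠ 0)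
    (X₀ : State) {W : ℝ → EnergyVec} (hW : IsMildSolution (statOp c₁ g c₂ h) W)
    (hW0 : W 0 = X₀.energyVec) : ∃ X, IsSolution c₁ g c₂ h 0 X₀ X := by
  set D : ℝ≥0 → EnergyVec := fun t => W t - W 0 with hD
  have hs := fun t => isStationary_stat hc₁ hc₂ hgh (D t)
  -- The displacement `u(t) - u(0)` must be the velocity component of `∫₀ᵗ X`, which is the `p` of
  -- the stationary problem with data `D t`; likewise for `v`.
  have hmem : ∀ t : ℝ≥0, (X₀.u + statP c₁ g c₂ h (D t), W t 1, X₀.v + statR c₁ g c₂ h (D t), W t 3) ∈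
      energySpace := by
    intro t
    change X₀.u.value 1 + (statP c₁ g c₂ h (D t)).value 1 =
      X₀.v.value 0 + (statR c₁ g c₂ h (D t)).value 0
    rw [X₀.value_one_eq, (hs t).middle_vel]
  set X : ℝ≥0 → State := fun t => ⟨_, hmem t⟩ with hX
  have hWc : Continuous fun t : ℝ≥0 => W t := hW.1.comp continuous_subtype_val
  have hDc : Continuous D := hWc.sub continuous_const
  have hXc : Continuous X := by
    refine Continuous.subtype_mk ?_ _
    have h1 := (EnergyVec.coord 1).continuous.comp hWc
    have h3 := (EnergyVec.coord 3).continuous.comp hWc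
    exact ((continuous_const.add ((statP c₁ g c₂ h).continuous.comp hDc)).prodMk
      (h1.prodMk ((continuous_const.add ((statR c₁ g c₂ h).continuous.comp hDc)).prodMk h3)))
  have hXW : ∀ t, (X t).energyVec = W t := by
    intro t
    refine EnergyVec.ext_coords ?_ rfl ?_ rfl
    · change X₀.u.dx + (statP c₁ g c₂ h (D t)).dx = W t 0
      rw [(hs t).dx_p]
      change X₀.u.dx + (W t 0 - W 0 0) = _
      rw [hW0]
      exact add_sub_cancel _ _
    · change X₀.v.dx + (statR c₁ g c₂ h (D t)).dx = W t 2
      rw [(hs t).dx_r]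
      change X₀.v.dx + (W t 2 - W 0 2) = _
      rw [hW0]
      exact add_sub_cancel _ _
  have hX0 : X 0 = X₀ := by
    have hD0 : D 0 = 0 := by simp [hD]
    refine State.ext_components ?_ (congrArg (fun x : EnergyVec => x 1) hW0) ?_
      (congrArg (fun x : EnergyVec => x 3) hW0)
    · change X₀.u + statP c₁ g c₂ h (D 0) = X₀.u
      rw [hD0, map_zero, add_zero]
    · change X₀.v + statR c₁ g c₂ h (D 0) = X₀.v
      rw [hD0, map_zero, add_zero]
  refine ⟨X, hX0, hXc, fun t => (isImageUnderA_iff hc₁ hc₂ hgh _ _).2 ?_⟩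
  have hZ : (X t - X₀).energyVec = D t := by rw [map_sub, hXW, ← hW0]
  have hc' : Continuous fun t : ℝ => X t.toNNReal := hXc.comp continuous_real_toNNReal
  rw [hZ]
  refine ⟨?_, ?_, ?_⟩
  · rw [hW.2 t t.2, ← State.energyVec.intervalIntegral_comp_comm (hc'.intervalIntegrable _ _)]
    refine intervalIntegral.integral_congr fun s hst => ?_
    have hst' := (uIcc_of_le t.2 ▸ hst : s ∈ Icc 0 (t : ℝ))
    simp only [hXW, Real.coe_toNNReal s hst'.1]
  · exact add_sub_cancel_left X₀.u _
  · exact add_sub_cancel_left X₀.v _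

theorem isExpStable_of_form {B : EnergyVec →L[ℝ] EnergyVec →L[ℝ] ℝ} {m K α : ℝ} (hm : 0 < m)
    (hα : 0 < α)
    (hB : ∀ x : EnergyVec,
      m * (c₁ ^ 2 * ‖x 0‖ ^ 2 + ‖x 1‖ ^ 2 + c₂ ^ 2 * ‖x 2‖ ^ 2 + ‖x 3‖ ^ 2) ≤ B x x ∧
      B x x ≤ K * (c₁ ^ 2 * ‖x 0‖ ^ 2 + ‖x 1‖ ^ 2 + c₂ ^ 2 * ‖x 2‖ ^ 2 + ‖x 3‖ ^ 2))
    {X : ℝ≥0 → State}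
    (hX : ∀ t : ℝ≥0, B (X t).energyVec (X t).energyVec ≤
      Real.exp (-(2 * α * t)) * B (X 0).energyVec (X 0).energyVec) :
    IsExpStable c₁ c₂ X := by
  set e : State → ℝ := fun Y =>
    c₁ ^ 2 * ‖Y.u.dx‖ ^ 2 + ‖Y.ut‖ ^ 2 + c₂ ^ 2 * ‖Y.v.dx‖ ^ 2 + ‖Y.vt‖ ^ 2 with he
  have he0 : ∀ Y, 0 ≤ e Y := fun Y => by positivity
  refine ⟨√(|K| / m) + 2, by linarith [Real.sqrt_nonneg (|K| / m)], α, hα, fun t => ?_⟩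
  have h1 : m * e (X t) ≤ Real.exp (-(2 * α * t)) * (K * e (X 0)) :=
    ((hB (X t).energyVec).1.trans (hX t)).trans
      (mul_le_mul_of_nonneg_left (hB (X 0).energyVec).2 (Real.exp_pos _).le)
  have h2 : e (X t) ≤ |K| / m * e (X 0) * Real.exp (-α * t) ^ 2 := by
    have h3 : Real.exp (-α * t) ^ 2 = Real.exp (-(2 * α * t)) := by
      rw [← Real.exp_nat_mul]
      congr 1
      push_cast
      ring
    rw [h3, div_mul_eq_mul_div, div_mul_eq_mul_div, le_div_iff₀ hm]
    calc e (X t) * m ≤ Real.exp (-(2 * α * t)) * (K * e (X 0)) := by linarith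
      _ ≤ Real.exp (-(2 * α * t)) * (|K| * e (X 0)) := by
        gcongr
        exact le_abs_self K
      _ = _ := by ring
  calc energySeminorm c₁ c₂ (X t) = √(e (X t)) := rfl
    _ ≤ √(|K| / m * e (X 0) * Real.exp (-α * t) ^ 2) := Real.sqrt_le_sqrt h2
    _ = √(|K| / m) * √(e (X 0)) * Real.exp (-α * t) := by
      have hKm : 0 ≤ |K| / m := by positivity
      rw [Real.sqrt_mul (mul_nonneg hKm (he0 _)), Real.sqrt_mul hKm,
        Real.sqrt_sq (Real.exp_pos _).le]
    _ ≤ (√(|K| / m) + 2) * √(e (X 0)) * Real.exp (-α * t) := by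
      gcongr
      linarith

/-- Well-posedness and exponential stability of the closed loop with `q = 0` under strict
dissipation at the boundary. -/
theorem existsUnique_isSolution_and_isExpStable {S₁ S₂ S₃ S₄ ε : ℝ} (hc₁ : 0 < c₁) (hc₂ : 0 < c₂)
    (hS₁ : 0 < S₁) (hS₂ : 0 < S₂) (hS₃ : 0 < S₃) (hS₄ : 0 < S₄) (hε : 0 < ε) (hgh : g + h ≠ 0)
    (hM : BoundaryMargin c₁ g c₂ h S₁ S₂ S₃ S₄ ε) (X₀ : State) :
    (∃! X : ℝ≥0 → State, IsSolution c₁ g c₂ h 0 X₀ X) ∧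
      ∀ X : ℝ≥0 → State, IsSolution c₁ g c₂ h 0 X₀ X → IsExpStable c₁ c₂ X := by
  have hcoer := isCoercive_lyapunovForm hc₁ hc₂ hS₁ hS₂ hS₃ hS₄ hε
  have hsymm := lyapunovForm_symm c₁ c₂ S₁ S₂ S₃ S₄ ε
  have hdecay := lyapunovForm_stat_le hc₁ hc₂ hS₁ hS₂ hS₃ hS₄ hε hgh hM
  obtain ⟨m, K, hm, -, hmK⟩ := lyapunovForm_bounds hc₁ hc₂ hS₁ hS₂ hS₃ hS₄ hε
  set B := lyapunovForm c₁ c₂ S₁ S₂ S₃ S₄ ε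
  set α := ε * min c₁ c₂ / (2 * (1 + ε)) with hα
  have hα0 : 0 < α := by
    have := lt_min hc₁ hc₂
    positivity
  have hdiss : ∀ f, B (statOp c₁ g c₂ h f) f ≤ 0 := fun f => by
    have h1 : 0 ≤ B (statOp c₁ g c₂ h f) (statOp c₁ g c₂ h f) :=
      le_trans (by positivity) (hmK _).1
    nlinarith [hdecay f]
  refine ⟨?_, fun X hX => isExpStable_of_form hm hα0 hmK fun t => ?_⟩
  · obtain ⟨W, hW, hW0⟩ := exists_isMildSolution hcoer hsymm hdiss
      (fun f => statOp_injective hc₁.ne' hc₂.ne' hgh) X₀.energyVec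
    obtain ⟨X, hX⟩ := exists_isSolution_of_isMildSolution hc₁.ne' hc₂.ne' hgh X₀ hW hW0
    refine ⟨X, hX, fun Y hY => IsSolution.eq_of_energyVec_eq hc₁.ne' hc₂.ne' hgh hY hX fun t => ?_⟩
    have h1 := (hY.isMildSolution hc₁.ne' hc₂.ne' hgh).eq_of_dissipative hcoer hsymm hdiss
      (hX.isMildSolution hc₁.ne' hc₂.ne' hgh)
      (by simp only [Real.toNNReal_zero, hX.1, hY.1]) t.2
    simpa using h1
  · simpa using (hX.isMildSolution hc₁.ne' hc₂.ne' hgh).energy_le hsymm hdecay t.2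

end ClosedLoop

end

end StringLoop

theorem mainTheorem2
    (cmin cmax gmin gmax zmax c₂ h q : ℝ) (S₁ S₂ S₃ S₄ S₅ : ℝ)
    (hcmin : 0 < cmin) (hc₂ : 0 < c₂)
    (hS₁ : 0 < S₁) (hS₂ : 0 < S₂) (hS₃ : 0 < S₃) (hS₄ : 0 < S₄)
    -- `zmax` is a point of the uncertainty set at which the maximum is attained
    (hzmax : zmax ∈ StringLoop.uncertaintySet cmin cmax gmin gmax)
    (hzmax' : StringLoop.reflection zmax = StringLoop.deltaMax cmin cmax gmin gmax)
    (hδ₁ : 1 ≤ StringLoop.deltaMax cmin cmax gmin gmax)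
    (hδ₂ : StringLoop.deltaMax cmin cmax gmin gmax < ⊤)
    -- the matrix inequalities at the two vertices, for `Ψ` or, when `q = 0`, for `Ψ̃`
    (hLMI :
      (StringLoop.IsNegDef (StringLoop.matPsi c₂ h q S₁ S₂ S₃ S₄ S₅ 0 cmin zmax) ∧
        StringLoop.IsNegDef (StringLoop.matPsi c₂ h q S₁ S₂ S₃ S₄ S₅ 0 cmax zmax)) ∨
      (q = 0 ∧
        StringLoop.IsNegDef (StringLoop.matPsiTilde c₂ h q S₁ S₂ S₃ S₄ S₅ cmin zmax) ∧
        StringLoop.IsNegDef (StringLoop.matPsiTilde c₂ h q S₁ S₂ S₃ S₄ S₅ cmax zmax))) :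
    ∀ c₁ ∈ Set.Icc cmin cmax, ∀ g ∈ Set.Icc gmin gmax, ∀ X₀ : StringLoop.State,
      (∃! X : NNReal → StringLoop.State, StringLoop.IsSolution c₁ g c₂ h q X₀ X) ∧
      ∀ X : NNReal → StringLoop.State, StringLoop.IsSolution c₁ g c₂ h q X₀ X →
        StringLoop.IsExpStable c₁ c₂ X := by
  intro c₁ hc₁ g hg X₀
  obtain ⟨rfl, hl, hm, hr⟩ := StringLoop.boundary_dissipation_of_negDef hS₁ hS₂ hzmax' hδ₁ hδ₂
    hLMI hc₁ hg
  obtain ⟨ε, hε, hM⟩ := StringLoop.exists_boundaryMargin hl hm hr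
  exact StringLoop.existsUnique_isSolution_and_isExpStable (hcmin.trans_le hc₁.1) hc₂ hS₁ hS₂ hS₃
    hS₄ hε (StringLoop.add_ne_zero_of_boundary_dissipation hl hm hr) hM X₀
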